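/- Let $G$ be a finite simple graph on $n$ vertices and let $k$ be a natural number. A proper coloring $\varphi\colon V(G)\to\{1,\dots,k\}$ is *equitable* if $\lfloor n/k\rfloor\le|\varphi^{-1}(i)|\le\lceil n/k\rceil$ for every color $i$. The problem Equitable Coloring asks, given $(G,k)$, whether $G$ has an equitable proper $k$-coloring. A *cluster graph* is a graph each of whose connected components is a clique, a *co-cluster graph* is the complement of a cluster graph, and the *distance to co-cluster* $\mathrm{dcc}(G)$ is the smallest size of a set $U\subseteq V(G)$ such that $G-U$ is a co-cluster graph. **Theorem.** Equitable Coloring is fixed-parameter tractable when parameterized by distance to co-cluster: there are a computable function $f\colon\mathbb N\to\mathbb N$, a constant $c$ and an algorithm (a program of a uniform-cost random access machine with addition, truncated subtraction and indirect addressing) that, given $(G,k)$ encoded by $n$, $k$ and the adjacency matrix of $G$, correctly decides whether $G$ has an equitable proper $k$-coloring in at most $f(\mathrm{dcc}(G))\cdot|(G,k)|^{c}$ steps, where $|(G,k)|$ is the binary length of the input. Neither a modulator $U$ nor the value $\mathrm{dcc}(G)$ is part of the input. -/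

import Mathlib

/-! ## Random access machines

Programs act on natural-number scalars `x₀, x₁, …` and natural-number arrays `A₀, A₁, …`;
a fixed program mentions only finitely many of them. The arithmetic operations are addition and
truncated subtraction (no multiplication), every elementary operation costs one step, and
indirect addressing is allowed: the uniform-cost RAM, with structured control flow. -/

namespace RAM

/-- Contents of the scalar variables and of the arrays. -/
structure State where
  var : ℕ → ℕ
  arr : ℕ → ℕ → ℕ

/-- Expressions. -/
inductive Expr where
  /-- a constant -/
  | const (c : ℕ)
  /-- the value of the scalar `x` -/
  | var (x : ℕ)
  /-- the entry of the array `a` at the index given by `i` -/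
  | read (a : ℕ) (i : Expr)
  /-- sum -/
  | add (e₁ e₂ : Expr)
  /-- difference, cut off at `0` -/
  | sub (e₁ e₂ : Expr)

/-- Value of an expression. -/
def Expr.eval (s : State) : Expr → ℕ
  | .const c => c
  | .var x => s.var x
  | .read a i => s.arr a (i.eval s)
  | .add e₁ e₂ => e₁.eval s + e₂.eval s
  | .sub e₁ e₂ => e₁.eval s - e₂.eval s

/-- Number of steps needed to evaluate an expression: one for each node. -/
def Expr.cost : Expr → ℕ
  | .const _ => 1
  | .var _ => 1
  | .read _ i => i.cost + 1
  | .add e₁ e₂ => e₁.cost + e₂.cost + 1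
  | .sub e₁ e₂ => e₁.cost + e₂.cost + 1

/-- Programs. -/
inductive Prog where
  /-- do nothing -/
  | skip
  /-- `x := e` -/
  | assign (x : ℕ) (e : Expr)
  /-- `a[i] := e` -/
  | write (a : ℕ) (i e : Expr)
  /-- first `p`, then `q` -/
  | seq (p q : Prog)
  /-- `p` if `e ≠ 0`, and `q` otherwise -/
  | branch (e : Expr) (p q : Prog)
  /-- repeat `p` as long as `e ≠ 0` -/
  | loop (e : Expr) (p : Prog)

/-- The state after `x := v`. -/
def State.setVar (s : State) (x v : ℕ) : State :=
  { s with var := Function.update s.var x v }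

/-- The state after `a[i] := v`. -/
def State.setArr (s : State) (a i v : ℕ) : State :=
  { s with arr := Function.update s.arr a (Function.update (s.arr a) i v) }

/-- `Exec p s t s'`: started in the state `s`, the program `p` halts after exactly `t` steps in
the state `s'`. -/
inductive Exec : Prog → State → ℕ → State → Prop where
  | skip (s : State) : Exec .skip s 1 s
  | assign (s : State) (x : ℕ) (e : Expr) :
      Exec (.assign x e) s (e.cost + 1) (s.setVar x (e.eval s))
  | write (s : State) (a : ℕ) (i e : Expr) :
      Exec (.write a i e) s (i.cost + e.cost + 1) (s.setArr a (i.eval s) (e.eval s))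
  | seq {p q : Prog} {s₁ s₂ s₃ : State} {t₁ t₂ : ℕ} :
      Exec p s₁ t₁ s₂ → Exec q s₂ t₂ s₃ → Exec (.seq p q) s₁ (t₁ + t₂) s₃
  | branch_true {e : Expr} {p q : Prog} {s s' : State} {t : ℕ} :
      e.eval s ≠ 0 → Exec p s t s' → Exec (.branch e p q) s (e.cost + 1 + t) s'
  | branch_false {e : Expr} {p q : Prog} {s s' : State} {t : ℕ} :
      e.eval s = 0 → Exec q s t s' → Exec (.branch e p q) s (e.cost + 1 + t) s'
  | loop_false {e : Expr} {p : Prog} {s : State} :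
      e.eval s = 0 → Exec (.loop e p) s (e.cost + 1) s
  | loop_true {e : Expr} {p : Prog} {s₁ s₂ s₃ : State} {t₁ t₂ : ℕ} :
      e.eval s₁ ≠ 0 → Exec p s₁ t₁ s₂ → Exec (.loop e p) s₂ t₂ s₃ →
      Exec (.loop e p) s₁ (e.cost + 1 + t₁ + t₂) s₃

/-- The initial state on the input `w`: the array `A₀` holds `w`, the scalar `x₀` holds the
length of `w`, and everything else is `0`. -/
def init (w : List ℕ) : State where
  var := fun x => if x = 0 then w.length else 0
  arr := fun a i => if a = 0 then w.getD i 0 else 0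

/-- Size of an input word: its total length in binary, with one separator for each number. -/
def inputSize (w : List ℕ) : ℕ := (w.map fun a => Nat.size a + 1).sum

end RAM

/-! ## Fixed-parameter tractability -/

/-- A parameterized decision problem: instances, their encoding as an input word, the
yes-instances, and the parameter of an instance. -/
structure ParamProblem where
  Inst : Type
  encode : Inst → List ℕ
  Yes : Inst → Prop
  param : Inst → ℕ

/-- One program halts on every instance `x`, with output `1` in `x₀` if `x` is a yes-instance and
output `0` otherwise, within `f (param x) * |x| ^ c` steps, where `f` is a computable function and
`c` a constant. The program sees only the encoding of `x`, not the parameter. -/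
def ParamProblem.IsFPT (P : ParamProblem) : Prop :=
  ∃ (p : RAM.Prog) (f : ℕ → ℕ) (c : ℕ), Computable f ∧
    ∀ x : P.Inst, ∃ (t : ℕ) (s : RAM.State),
      RAM.Exec p (RAM.init (P.encode x)) t s ∧
      t ≤ f (P.param x) * RAM.inputSize (P.encode x) ^ c ∧
      (P.Yes x → s.var 0 = 1) ∧ (¬ P.Yes x → s.var 0 = 0)

/-! ## Equitable coloring and distance to co-cluster -/

namespace SimpleGraph

/-- `G` has a proper `k`-coloring whose color classes all have size between `⌊n/k⌋` and `⌈n/k⌉`,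
where `n` is the number of vertices. -/
def EquitablyColorable {V : Type*} [Fintype V] (G : SimpleGraph V) (k : ℕ) : Prop :=
  ∃ φ : G.Coloring (Fin k), ∀ i : Fin k,
    Fintype.card V / k ≤ (φ.colorClass i).ncard ∧
    (φ.colorClass i).ncard ≤ Fintype.card V ⌈/⌉ k

/-- Each connected component is a clique. -/
def IsCluster {V : Type*} (G : SimpleGraph V) : Prop :=
  ∀ C : G.ConnectedComponent, G.IsClique C.supp

/-- Complement of a cluster graph. -/
def IsCoCluster {V : Type*} (G : SimpleGraph V) : Prop :=
  Gᶜ.IsCluster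

/-- The smallest size of a set `U` of vertices such that `G - U` is a co-cluster graph. -/
noncomputable def distToCoCluster {V : Type*} [Fintype V] (G : SimpleGraph V) : ℕ :=
  sInf {m | ∃ U : Finset V, U.card = m ∧ (G.induce {v | v ∉ U}).IsCoCluster}

end SimpleGraph

/-- An instance of Equitable Coloring: a finite graph, on the vertices `0, …, n - 1`, and the
number `k` of colors. -/
structure EqColInstance where
  n : ℕ
  G : SimpleGraph (Fin n)
  k : ℕ

open Classical in
/-- The input word `n, k` followed by the `n²` entries of the adjacency matrix, row by row. -/
noncomputable def EqColInstance.encode (x : EqColInstance) : List ℕ :=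
  x.n :: x.k ::
    List.ofFn fun t : Fin (x.n * x.n) => if x.G.Adj t.divNat t.modNat then 1 else 0

/-- Equitable Coloring parameterized by distance to co-cluster. -/
noncomputable def equitableColoringByDistToCoCluster : ParamProblem where
  Inst := EqColInstance
  encode := EqColInstance.encode
  Yes := fun x => x.G.EquitablyColorable x.k
  param := fun x => x.G.distToCoCluster

/-! ## Functions computable in fixed-parameter time -/

namespace ParamProblem

/-- `T` is bounded by a computable function of the parameter times a polynomial in the size. -/
def FPTBounded (P : ParamProblem) (T : P.Inst → ℕ) : Prop :=
  ∃ (f : ℕ → ℕ) (c : ℕ), Computable f ∧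
    ∀ x, T x ≤ f (P.param x) * (RAM.inputSize (P.encode x) + 1) ^ c

variable {P : ParamProblem}

theorem FPTBounded.mono {T T' : P.Inst → ℕ} (h : P.FPTBounded T) (hT : ∀ x, T' x ≤ T x) :
    P.FPTBounded T' := by
  obtain ⟨f, c, hf, hb⟩ := h
  exact ⟨f, c, hf, fun x => (hT x).trans (hb x)⟩

theorem FPTBounded.of_param {f : ℕ → ℕ} (hf : Computable f) :
    P.FPTBounded fun x => f (P.param x) :=
  ⟨f, 0, hf, fun x => by simp⟩

theorem FPTBounded.const (m : ℕ) : P.FPTBounded fun _ => m :=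
  FPTBounded.of_param (f := fun _ => m) (Computable.const m)

theorem FPTBounded.of_size {T : P.Inst → ℕ} (hT : ∀ x, T x ≤ RAM.inputSize (P.encode x)) :
    P.FPTBounded T :=
  ⟨fun _ => 1, 1, Computable.const 1, fun x => by simpa using (hT x).trans (Nat.le_succ _)⟩

theorem FPTBounded.mul {T T' : P.Inst → ℕ} (h : P.FPTBounded T) (h' : P.FPTBounded T') :
    P.FPTBounded fun x => T x * T' x := by
  obtain ⟨f, c, hf, hb⟩ := h
  obtain ⟨f', c', hf', hb'⟩ := h'
  refine ⟨fun d => f d * f' d, c + c', ?_, fun x => ?_⟩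
  · exact (Primrec.nat_mul.to_comp : Computable₂ fun a b : ℕ => a * b).comp hf hf'
  · calc _ ≤ _ := Nat.mul_le_mul (hb x) (hb' x)
      _ = _ := by rw [pow_add]; ring

theorem FPTBounded.add {T T' : P.Inst → ℕ} (h : P.FPTBounded T) (h' : P.FPTBounded T') :
    P.FPTBounded fun x => T x + T' x := by
  obtain ⟨f, c, hf, hb⟩ := h
  obtain ⟨f', c', hf', hb'⟩ := h'
  refine ⟨fun d => f d + f' d, c + c', ?_, fun x => ?_⟩
  · exact (Primrec.nat_add.to_comp : Computable₂ fun a b : ℕ => a + b).comp hf hf'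
  · have hN := Nat.succ_pos (RAM.inputSize (P.encode x))
    have h1 := Nat.pow_le_pow_right hN (Nat.le_add_right c c')
    have h2 := Nat.pow_le_pow_right hN (Nat.le_add_left c' c)
    calc _ ≤ _ := Nat.add_le_add (hb x) (hb' x)
      _ ≤ _ := Nat.add_le_add (Nat.mul_le_mul_left _ h1) (Nat.mul_le_mul_left _ h2)
      _ = _ := by rw [add_mul]

end ParamProblem

namespace RAM

open ParamProblem

variable {P : ParamProblem} {α : Type}

/-- A context: a family of situations, each coming with an instance whose encoding is held by the
array `A₀`, and with the values of finitely many variables. -/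
structure Ctx (P : ParamProblem) (α : Type) where
  arity : ℕ
  val : α → ℕ → ℕ
  inst : α → P.Inst

/-- The context with one more variable. -/
def Ctx.ext (Γ : Ctx P α) : Ctx P (α × ℕ) where
  arity := Γ.arity + 1
  val := fun a x => if x = Γ.arity then a.2 else Γ.val a.1 x
  inst := fun a => Γ.inst a.1

/-- The context without variables. -/
def Ctx.base (P : ParamProblem) : Ctx P P.Inst where
  arity := 0
  val := fun _ _ => 0
  inst := id

/-- `F` can be computed in fixed-parameter time from the variables of the context. For each
placement `σ` of these variables in registers below `b` there is a program that writes the value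
of `F` into the register `b` and changes only registers from `b` on. -/
def Comp (Γ : Ctx P α) (F : α → ℕ) : Prop :=
  ∃ T : P.Inst → ℕ, P.FPTBounded T ∧
    ∀ (σ : ℕ → ℕ) (b : ℕ), (∀ x < Γ.arity, σ x < b) →
      ∃ p : Prog, ∀ (a : α) (s : State), (∀ x < Γ.arity, s.var (σ x) = Γ.val a x) →
        s.arr 0 = (fun i => (P.encode (Γ.inst a)).getD i 0) →
        ∃ (t : ℕ) (s' : State), Exec p s t s' ∧ t ≤ T (Γ.inst a) ∧ s'.var b = F a ∧
          (∀ x < b, s'.var x = s.var x) ∧ s'.arr = s.arr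

theorem Comp.congr {Γ : Ctx P α} {F G : α → ℕ} (h : Comp Γ F) (hFG : ∀ a, F a = G a) :
    Comp Γ G := (funext hFG : F = G) ▸ h

theorem Comp.const (Γ : Ctx P α) (m : ℕ) : Comp Γ fun _ => m := by
  refine ⟨fun _ => 2, .const 2, fun σ b _ => ⟨.assign b (.const m), fun a s _ _ =>
    ⟨_, _, .assign _ _ _, le_rfl, ?_, fun x hx => ?_, rfl⟩⟩⟩
  · simp [State.setVar, Expr.eval]
  · simp [State.setVar, hx.ne]

theorem Comp.var (Γ : Ctx P α) {x : ℕ} (hx : x < Γ.arity) : Comp Γ fun a => Γ.val a x := by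
  refine ⟨fun _ => 2, .const 2, fun σ b _ => ⟨.assign b (.var (σ x)), fun a s hs _ =>
    ⟨_, _, .assign _ _ _, le_rfl, ?_, fun y hy => ?_, rfl⟩⟩⟩
  · simp [State.setVar, Expr.eval, hs x hx]
  · simp [State.setVar, hy.ne]

/-- The innermost variable. -/
theorem Comp.last (Γ : Ctx P α) : Comp Γ.ext fun a => a.2 :=
  (Comp.var Γ.ext (x := Γ.arity) (Nat.lt_succ_self _)).congr fun a => by simp [Ctx.ext]

/-- Weakening. -/
theorem Comp.wk {Γ : Ctx P α} {F : α → ℕ} (h : Comp Γ F) : Comp Γ.ext fun a => F a.1 := by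
  obtain ⟨T, hT, h⟩ := h
  refine ⟨T, hT, fun σ b hσ => ?_⟩
  obtain ⟨p, hp⟩ := h σ b fun x hx => hσ x (Nat.lt_succ_of_lt hx)
  refine ⟨p, fun a s hs hA => hp a.1 s (fun x hx => ?_) hA⟩
  rw [hs x (Nat.lt_succ_of_lt hx)]
  simp [Ctx.ext, hx.ne]

/-- Reading the input. -/
theorem Comp.read {Γ : Ctx P α} {F : α → ℕ} (h : Comp Γ F) :
    Comp Γ fun a => (P.encode (Γ.inst a)).getD (F a) 0 := by
  obtain ⟨T, hT, h⟩ := h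
  refine ⟨_, hT.add (.const 3), fun σ b hσ => ?_⟩
  obtain ⟨p, hp⟩ := h σ b hσ
  refine ⟨.seq p (.assign b (.read 0 (.var b))), fun a s hs hA => ?_⟩
  obtain ⟨t, s', he, ht, hv, hx, harr⟩ := hp a s hs hA
  refine ⟨_, _, .seq he (.assign _ _ _), Nat.add_le_add_right ht _, ?_, fun y hy => ?_, harr⟩
  · simp [State.setVar, Expr.eval, hv, harr, hA]
  · simp [State.setVar, hy.ne, hx y hy]

theorem Comp.binary {Γ : Ctx P α} {F G : α → ℕ} (hF : Comp Γ F) (hG : Comp Γ G)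
    (op : ℕ → ℕ → ℕ) (e : Expr → Expr → Expr)
    (he : ∀ s e₁ e₂, (e e₁ e₂).eval s = op (e₁.eval s) (e₂.eval s))
    (hc : ∀ e₁ e₂, (e e₁ e₂).cost = e₁.cost + e₂.cost + 1) :
    Comp Γ fun a => op (F a) (G a) := by
  obtain ⟨T, hT, hF⟩ := hF
  obtain ⟨T', hT', hG⟩ := hG
  refine ⟨_, (hT.add hT').add (.const 4), fun σ b hσ => ?_⟩
  obtain ⟨p, hp⟩ := hF σ b hσ
  obtain ⟨q, hq⟩ := hG σ (b + 1) fun x hx => (hσ x hx).trans (Nat.lt_succ_self b)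
  refine ⟨.seq (.seq p q) (.assign b (e (.var b) (.var (b + 1)))), fun a s hs hA => ?_⟩
  obtain ⟨t, s', hE, ht, hv, hx, harr⟩ := hp a s hs hA
  obtain ⟨t', s'', hE', ht', hv', hx', harr'⟩ := hq a s'
    (fun x h => by rw [hx _ (hσ x h), hs x h]) (by rw [harr, hA])
  refine ⟨_, _, .seq (.seq hE hE') (.assign _ _ _), ?_, ?_, fun y hy => ?_, harr'.trans harr⟩
  · rw [hc]; exact Nat.add_le_add_right (Nat.add_le_add ht ht') _
  · simp [State.setVar, he, Expr.eval, hv', hx' b (Nat.lt_succ_self b), hv]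
  · simp [State.setVar, hy.ne, hx' y (hy.trans (Nat.lt_succ_self b)), hx y hy]

theorem Comp.add {Γ : Ctx P α} {F G : α → ℕ} (hF : Comp Γ F) (hG : Comp Γ G) :
    Comp Γ fun a => F a + G a :=
  hF.binary hG _ .add (fun _ _ _ => rfl) fun _ _ => rfl

theorem Comp.sub {Γ : Ctx P α} {F G : α → ℕ} (hF : Comp Γ F) (hG : Comp Γ G) :
    Comp Γ fun a => F a - G a :=
  hF.binary hG _ .sub (fun _ _ _ => rfl) fun _ _ => rfl

/-- The value of an accumulator after a number of rounds. -/
def rounds (init : ℕ) (body : ℕ → ℕ → ℕ) : ℕ → ℕ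
  | 0 => init
  | t + 1 => body t (rounds init body t)

/-- Computable functions of the instance that are small enough to bound the length of a loop. -/
structure LoopBound (B : P.Inst → ℕ) : Prop where
  bounded : P.FPTBounded B
  comp : ∀ {α : Type} (Γ : Ctx P α), Comp Γ fun a => B (Γ.inst a)

/-- Bounded iteration. -/
theorem Comp.rounds {Γ : Ctx P α} {B : P.Inst → ℕ} {F : α → ℕ} {G : α → ℕ → ℕ → ℕ}
    (hB : LoopBound B) (hF : Comp Γ F) (hG : Comp Γ.ext.ext fun a => G a.1.1 a.1.2 a.2) :
    Comp Γ fun a => rounds (F a) (G a) (B (Γ.inst a)) := by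
  have hbd := hB.bounded
  obtain ⟨TB, hTB, hB⟩ := hB.comp Γ
  obtain ⟨TF, hTF, hF⟩ := hF
  obtain ⟨TG, hTG, hG⟩ := hG
  refine ⟨_, (hTB.add hTF).add ((hbd.mul (hTG.add (.const 10))).add (.const 8)),
    fun σ b hσ => ?_⟩
  obtain ⟨pB, hpB⟩ := hB σ b hσ
  obtain ⟨pF, hpF⟩ := hF σ (b + 1) fun x hx => (hσ x hx).trans (Nat.lt_succ_self b)
  obtain ⟨pG, hpG⟩ := hG
    (fun x => if x = Γ.arity then b + 2 else if x = Γ.arity + 1 then b + 1 else σ x) (b + 3)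
    (fun x hx => by
      have hx : x < Γ.arity + 1 + 1 := hx
      split_ifs with h1 h2
      · omega
      · omega
      · have := hσ x (by omega); omega)
  let body : Prog := .seq pG (.seq (.assign (b + 1) (.var (b + 3)))
    (.assign (b + 2) (.add (.var (b + 2)) (.const 1))))
  let cond : Expr := .sub (.var b) (.var (b + 2))
  refine ⟨.seq (.seq pB pF) (.seq (.assign (b + 2) (.const 0))
    (.seq (.loop cond body) (.assign b (.var (b + 1))))), fun a s hs hA => ?_⟩
  obtain ⟨t₁, s₁, hE₁, ht₁, hv₁, hx₁, harr₁⟩ := hpB a s hs hA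
  obtain ⟨t₂, s₂, hE₂, ht₂, hv₂, hx₂, harr₂⟩ := hpF a s₁
    (fun x h => by rw [hx₁ _ (hσ x h), hs x h]) (by rw [harr₁, hA])
  have loop : ∀ r i : ℕ, r + i = B (Γ.inst a) → ∀ z : State, z.var b = B (Γ.inst a) →
      z.var (b + 1) = RAM.rounds (F a) (G a) i → z.var (b + 2) = i →
      (∀ x < b, z.var x = s.var x) → z.arr = s.arr →
      ∃ (t : ℕ) (z' : State), Exec (.loop cond body) z t z' ∧
        t ≤ r * (TG (Γ.inst a) + 10) + 4 ∧
        z'.var (b + 1) = RAM.rounds (F a) (G a) (B (Γ.inst a)) ∧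
        (∀ x < b, z'.var x = s.var x) ∧ z'.arr = s.arr := by
    intro r
    induction r with
    | zero =>
      intro i hi z hzb hz1 hz2 hzx hza
      refine ⟨_, z, .loop_false ?_, ?_, ?_, hzx, hza⟩
      · simp only [cond, Expr.eval, hzb, hz2]; omega
      · simp [cond, Expr.cost]
      · rw [hz1]; congr 1; omega
    | succ r ih =>
      intro i hi z hzb hz1 hz2 hzx hza
      obtain ⟨t, z₁, hE, ht, hv, hx, harr⟩ := hpG ((a, i), RAM.rounds (F a) (G a) i) z
        (fun x hx => by
          have hx : x < Γ.arity + 1 + 1 := hx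
          simp only [Ctx.ext]
          by_cases h1 : x = Γ.arity
          · simp [h1, hz2]
          · by_cases h2 : x = Γ.arity + 1
            · simp [h2, hz1]
            · have hxl : x < Γ.arity := by omega
              simp [h1, h2, hzx _ (hσ x hxl), hs x hxl])
        (by rw [hza, hA]; rfl)
      obtain ⟨t', z', hE', ht', h1', h2', h3'⟩ := ih (i + 1) (by omega)
        ((z₁.setVar (b + 1) (z₁.var (b + 3))).setVar (b + 2) (z₁.var (b + 2) + 1))
        (by simp [State.setVar, hx b (by omega), hzb])
        (by simp [State.setVar, hv, RAM.rounds])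
        (by simp [State.setVar, hx (b + 2) (by omega), hz2])
        (fun x h => by
          have h1 : x ≠ b + 1 := by omega
          have h2 : x ≠ b + 2 := by omega
          simp [State.setVar, h1, h2, hx x (by omega), hzx x h])
        (by simp [State.setVar, harr, hza])
      refine ⟨_, z', .loop_true (t₂ := t') ?_
        (.seq hE (.seq (.assign _ _ _) (.assign _ _ _))) ?_, ?_, h1', h2', h3'⟩
      · simp only [cond, Expr.eval, hzb, hz2]; omega
      · convert hE' using 1
        simp [Expr.eval, State.setVar]
      · simp only [cond, Expr.cost]
        have ht : t ≤ TG (Γ.inst a) := ht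
        rw [Nat.add_mul]
        omega
  obtain ⟨t₃, s₃, hE₃, ht₃, hv₃, hx₃, harr₃⟩ := loop (B (Γ.inst a)) 0 rfl (s₂.setVar (b + 2) 0)
    (by simp [State.setVar, hx₂ b (by omega), hv₁])
    (by simp [State.setVar, hv₂, RAM.rounds])
    (by simp [State.setVar])
    (fun x h => by
      have h2 : x ≠ b + 2 := by omega
      simp [State.setVar, h2, hx₂ x (by omega), hx₁ x h])
    (by simp [State.setVar, harr₂, harr₁])
  refine ⟨_, _, .seq (.seq hE₁ hE₂) (.seq (.assign _ _ _) (.seq hE₃ (.assign _ _ _))), ?_, ?_,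
    fun y hy => ?_, harr₃⟩
  · simp only [Expr.cost]; omega
  · simp [State.setVar, Expr.eval, hv₃]
  · simp [State.setVar, hy.ne, hx₃ y hy]

/-- A problem is fixed-parameter tractable if its characteristic function is computable. -/
theorem isFPT_of_comp (hpos : ∀ x, 0 < inputSize (P.encode x)) {F : P.Inst → ℕ}
    (hF : Comp (Ctx.base P) F) (hyes : ∀ x, P.Yes x → F x = 1) (hno : ∀ x, ¬ P.Yes x → F x = 0) :
    P.IsFPT := by
  obtain ⟨T, ⟨f, c, hf, hT⟩, h⟩ := hF
  obtain ⟨p, hp⟩ := h id 0 fun x hx => absurd hx (Nat.not_lt_zero x)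
  refine ⟨p, fun d => f d * 2 ^ c, c, ?_, fun x => ?_⟩
  · exact (Primrec.nat_mul.to_comp : Computable₂ fun a b : ℕ => a * b).comp hf (.const _)
  obtain ⟨t, s, hE, ht, hv, -, -⟩ := hp x (init (P.encode x))
    (fun x hx => absurd hx (Nat.not_lt_zero x)) (by ext i; simp [init, Ctx.base])
  refine ⟨t, s, hE, ?_, fun h => hv.trans (hyes x h), fun h => hv.trans (hno x h)⟩
  calc t ≤ _ := ht
    _ ≤ _ := hT x
    _ ≤ f (P.param x) * (2 * inputSize (P.encode x)) ^ c :=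
      Nat.mul_le_mul_left _ (Nat.pow_le_pow_left (by have := hpos x; omega) c)
    _ = _ := by rw [mul_pow]; ring

end RAM

namespace RAM

open ParamProblem Finset

variable {P : ParamProblem} {α : Type} {Γ : Ctx P α}

open Classical in
/-- The truth value of a proposition. -/
noncomputable def ind (p : Prop) : ℕ := if p then 1 else 0

theorem ind_true {p : Prop} (h : p) : ind p = 1 := by simp [ind, h]

theorem ind_false {p : Prop} (h : ¬ p) : ind p = 0 := by simp [ind, h]

theorem ind_le_one (p : Prop) : ind p ≤ 1 := by
  by_cases h : p <;> simp [ind, h]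

/-- The predicate `p` can be decided in fixed-parameter time. -/
def CompP (Γ : Ctx P α) (p : α → Prop) : Prop := Comp Γ fun a => ind (p a)

theorem CompP.congr {p q : α → Prop} (h : CompP Γ p) (hpq : ∀ a, p a ↔ q a) : CompP Γ q :=
  (funext fun a => propext (hpq a) : p = q) ▸ h

theorem CompP.wk {p : α → Prop} (h : CompP Γ p) : CompP Γ.ext fun a => p a.1 := Comp.wk h

theorem LoopBound.const (m : ℕ) : LoopBound fun _ : P.Inst => m :=
  ⟨.const m, fun Γ => Comp.const Γ m⟩

theorem Comp.ne_zero {F : α → ℕ} (hF : Comp Γ F) : CompP Γ fun a => F a ≠ 0 :=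
  ((Comp.const Γ 1).sub ((Comp.const Γ 1).sub hF)).congr fun a => by
    by_cases h : F a = 0
    · simp [ind, h]
    · rw [ind_true h]; omega

theorem CompP.of_comp {F : α → ℕ} {p : α → Prop} (hF : Comp Γ F) (h : ∀ a, p a ↔ F a ≠ 0) :
    CompP Γ p := hF.ne_zero.congr fun a => (h a).symm

theorem CompP.not {p : α → Prop} (h : CompP Γ p) : CompP Γ fun a => ¬ p a :=
  .of_comp ((Comp.const Γ 1).sub h) fun a => by by_cases hp : p a <;> simp [ind, hp]

theorem CompP.or {p q : α → Prop} (hp : CompP Γ p) (hq : CompP Γ q) :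
    CompP Γ fun a => p a ∨ q a :=
  .of_comp (Comp.add hp hq) fun a => by
    by_cases h : p a <;> by_cases h' : q a <;> simp [ind, h, h']

theorem CompP.and {p q : α → Prop} (hp : CompP Γ p) (hq : CompP Γ q) :
    CompP Γ fun a => p a ∧ q a :=
  (hp.not.or hq.not).not.congr fun a => by tauto

theorem CompP.imp {p q : α → Prop} (hp : CompP Γ p) (hq : CompP Γ q) :
    CompP Γ fun a => p a → q a :=
  (hp.not.or hq).congr fun a => by tauto

theorem CompP.lt {F G : α → ℕ} (hF : Comp Γ F) (hG : Comp Γ G) : CompP Γ fun a => F a < G a :=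
  .of_comp (hG.sub hF) fun a => by omega

theorem CompP.le {F G : α → ℕ} (hF : Comp Γ F) (hG : Comp Γ G) : CompP Γ fun a => F a ≤ G a :=
  (CompP.lt hG hF).not.congr fun a => by omega

theorem CompP.eq {F G : α → ℕ} (hF : Comp Γ F) (hG : Comp Γ G) : CompP Γ fun a => F a = G a :=
  ((CompP.le hF hG).and (CompP.le hG hF)).congr fun a => by omega

theorem rounds_add (f : ℕ → ℕ) (B : ℕ) :
    rounds 0 (fun i acc => acc + f i) B = ∑ i ∈ range B, f i := by
  induction B with
  | zero => rfl
  | succ B ih => rw [rounds, ih, sum_range_succ]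

theorem Comp.sum {B : P.Inst → ℕ} {F : α → ℕ → ℕ} (hB : LoopBound B)
    (hF : Comp Γ.ext fun a => F a.1 a.2) : Comp Γ fun a => ∑ i ∈ range (B (Γ.inst a)), F a i :=
  (Comp.rounds (G := fun a i acc => acc + F a i) hB (Comp.const Γ 0)
    ((Comp.last _).add hF.wk)).congr fun _ => rounds_add _ _

/-- Multiplication by a loop bound. -/
theorem Comp.mul {B : P.Inst → ℕ} {F : α → ℕ} (hF : Comp Γ F) (hB : LoopBound B) :
    Comp Γ fun a => F a * B (Γ.inst a) :=
  (Comp.sum (F := fun a _ => F a) hB hF.wk).congr fun _ => by simp [mul_comm]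

theorem CompP.exists {B : P.Inst → ℕ} {p : α → ℕ → Prop} (hB : LoopBound B)
    (hp : CompP Γ.ext fun a => p a.1 a.2) : CompP Γ fun a => ∃ i < B (Γ.inst a), p a i :=
  .of_comp (Comp.sum (F := fun a i => ind (p a i)) hB hp) fun a => by
    simp [ind]

theorem CompP.forall {B : P.Inst → ℕ} {p : α → ℕ → Prop} (hB : LoopBound B)
    (hp : CompP Γ.ext fun a => p a.1 a.2) : CompP Γ fun a => ∀ i < B (Γ.inst a), p a i :=
  (CompP.exists (p := fun a i => ¬ p a i) hB hp.not).not.congr fun a => by push Not; rfl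

theorem Comp.ite {p : α → Prop} [∀ a, Decidable (p a)] {F G : α → ℕ}
    (hp : CompP Γ p) (hF : Comp Γ F) (hG : Comp Γ G) : Comp Γ fun a => if p a then F a else G a := by
  have key : ∀ {p : α → Prop} [∀ a, Decidable (p a)] {F : α → ℕ}, CompP Γ p → Comp Γ F →
      Comp Γ fun a => if p a then F a else 0 := by
    intro p _ F hp hF
    obtain ⟨T, hT, hF⟩ := hF
    obtain ⟨T', hT', hp⟩ := hp
    refine ⟨_, (hT'.add hT).add (.const 4), fun σ b hσ => ?_⟩
    obtain ⟨q', hq'⟩ := hp σ b hσ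
    obtain ⟨q, hq⟩ := hF σ b hσ
    refine ⟨.seq q' (.branch (.var b) q .skip), fun a s hs hA => ?_⟩
    obtain ⟨t, s', hE, ht, hv, hx, harr⟩ := hq' a s hs hA
    by_cases h : p a
    · obtain ⟨t', s'', hE', ht', hv', hx', harr'⟩ := hq a s'
        (fun x h => by rw [hx _ (hσ x h), hs x h]) (by rw [harr, hA])
      refine ⟨_, s'', .seq hE (.branch_true ?_ hE'), ?_, by simp [h, hv'],
        fun y hy => (hx' y hy).trans (hx y hy), harr'.trans harr⟩
      · simp [Expr.eval, hv, ind, h]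
      · simp only [Expr.cost]; omega
    · refine ⟨_, s', .seq hE (.branch_false ?_ (.skip _)), ?_, ?_, hx, harr⟩
      · simp [Expr.eval, hv, ind, h]
      · simp only [Expr.cost]; omega
      · simp [hv, ind, h]
  refine ((key hp hF).add (key hp.not hG)).congr fun a => ?_
  by_cases h : p a <;> simp [h]

/-- The number of `i < B` with `p i`. -/
noncomputable def count (B : ℕ) (p : ℕ → Prop) : ℕ := ∑ i ∈ range B, ind (p i)

theorem count_eq_card (B : ℕ) (p : ℕ → Prop) [DecidablePred p] :
    count B p = #{i ∈ range B | p i} := by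
  rw [card_filter]
  exact sum_congr rfl fun i _ => by by_cases h : p i <;> simp [ind, h]

theorem Comp.count {B : P.Inst → ℕ} {p : α → ℕ → Prop} (hB : LoopBound B)
    (hp : CompP Γ.ext fun a => p a.1 a.2) : Comp Γ fun a => count (B (Γ.inst a)) (p a) :=
  Comp.sum (F := fun a i => ind (p a i)) hB hp

open Classical in
/-- The sum of `f i` over the `i < B` with `p i`. -/
noncomputable def sumOver (B : ℕ) (p : ℕ → Prop) (f : ℕ → ℕ) : ℕ :=
  ∑ i ∈ range B, if p i then f i else 0

open Classical in
theorem Comp.sumOver {B : P.Inst → ℕ} {p : α → ℕ → Prop} {F : α → ℕ → ℕ} (hB : LoopBound B)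
    (hp : CompP Γ.ext fun a => p a.1 a.2) (hF : Comp Γ.ext fun a => F a.1 a.2) :
    Comp Γ fun a => sumOver (B (Γ.inst a)) (p a) (F a) :=
  Comp.sum (F := fun _ _ => _) hB (Comp.ite hp hF (Comp.const _ 0))

/-! ### Sets as numbers -/

theorem rounds_double (i S : ℕ) :
    rounds 1 (fun t acc => if t < i then acc + acc else acc) S = 2 ^ min i S := by
  induction S with
  | zero => simp [rounds]
  | succ S ih =>
    rw [rounds, ih]
    split_ifs with h
    · rw [min_eq_right h.le, min_eq_right h, pow_succ]; ring
    · rw [min_eq_left (by omega), min_eq_left (by omega)]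

theorem Comp.two_pow_min {B : P.Inst → ℕ} {F : α → ℕ} (hB : LoopBound B) (hF : Comp Γ F) :
    Comp Γ fun a => 2 ^ min (F a) (B (Γ.inst a)) := by
  refine (Comp.rounds (G := fun a t acc => if t < F a then acc + acc else acc) hB
    (Comp.const Γ 1) (Comp.ite (CompP.lt (Comp.last _).wk hF.wk.wk)
      ((Comp.last _).add (Comp.last _)) (Comp.last _))).congr fun a => rounds_double _ _

/-- The number whose binary digits below `S` are given by `p`. -/
noncomputable def tab (S : ℕ) (p : ℕ → Prop) : ℕ := sumOver S p fun i => 2 ^ i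

theorem tab_lt (S : ℕ) (p : ℕ → Prop) : tab S p < 2 ^ S := by
  induction S with
  | zero => simp [tab, sumOver]
  | succ S ih =>
    rw [tab, sumOver, sum_range_succ, ← sumOver, ← tab, pow_succ]
    split_ifs <;> omega

theorem testBit_tab {S : ℕ} {p : ℕ → Prop} {i : ℕ} (hi : i < S) :
    (tab S p).testBit i = true ↔ p i := by
  induction S with
  | zero => omega
  | succ S ih =>
    rw [tab, sumOver, sum_range_succ, ← sumOver, ← tab]
    rcases (Nat.lt_succ_iff.1 hi).lt_or_eq with h | rfl
    · rw [← ih h]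
      split_ifs
      · rw [add_comm, Nat.testBit_two_pow_add_gt h]
      · rfl
    · split_ifs with hp
      · simp [add_comm _ (2 ^ i), Nat.testBit_two_pow_add_eq,
          Nat.testBit_lt_two_pow (tab_lt i p), hp]
      · simp [Nat.testBit_lt_two_pow (tab_lt i p), hp]

theorem Comp.tab {B : P.Inst → ℕ} {p : α → ℕ → Prop} (hB : LoopBound B)
    (hp : CompP Γ.ext fun a => p a.1 a.2) : Comp Γ fun a => tab (B (Γ.inst a)) (p a) := by
  refine (Comp.sumOver (F := fun a i => 2 ^ min i (B (Γ.inst a))) hB hp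
    (Comp.two_pow_min hB (Comp.last _))).congr fun a => ?_
  refine Finset.sum_congr rfl fun i hi => ?_
  simp only [min_eq_left (Finset.mem_range.1 hi).le]

/-- `i` belongs to the subset of `{0, …, S - 1}` with the code `T`. -/
def Mem (S T i : ℕ) : Prop := T < 2 ^ S ∧ i < S ∧ T.testBit i = true

theorem mem_tab {S : ℕ} {p : ℕ → Prop} {i : ℕ} : Mem S (tab S p) i ↔ i < S ∧ p i :=
  ⟨fun h => ⟨h.2.1, (testBit_tab h.2.1).1 h.2.2⟩,
    fun h => ⟨tab_lt S p, h.1, (testBit_tab h.1).2 h.2⟩⟩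

theorem rounds_mod {S T i : ℕ} (hT : T < 2 ^ S) (hi : i < S) (r : ℕ) (hr : r ≤ S) :
    rounds T (fun t acc => if i < S - 1 - t ∧ 2 ^ min (S - 1 - t) S ≤ acc then
      acc - 2 ^ min (S - 1 - t) S else acc) r = T % 2 ^ max (i + 1) (S - r) := by
  induction r with
  | zero => rw [rounds, max_eq_right (by omega), Nat.sub_zero, Nat.mod_eq_of_lt hT]
  | succ r ih =>
    rw [rounds, ih (by omega)]
    by_cases h : i < S - 1 - r
    · obtain ⟨m, hm⟩ : ∃ m, S - r = m + 1 := ⟨S - 1 - r, by omega⟩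
      have hm' : S - 1 - r = m := by omega
      have hm'' : S - (r + 1) = m := by omega
      rw [hm', hm'', hm, max_eq_right (by omega), max_eq_right (by omega), min_eq_left (by omega)]
      have h1 : T % 2 ^ (m + 1) < 2 ^ m + 2 ^ m := by
        have := Nat.mod_lt T (Nat.two_pow_pos (m + 1)); rw [pow_succ] at this; omega
      have h2 : T % 2 ^ (m + 1) % 2 ^ m = T % 2 ^ m :=
        Nat.mod_mod_of_dvd _ (pow_dvd_pow 2 (Nat.le_succ m))
      rw [← h2]
      generalize T % 2 ^ (m + 1) = y at h1
      split_ifs with h3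
      · rw [Nat.mod_eq_sub_mod h3.2, Nat.mod_eq_of_lt (by omega)]
      · rw [Nat.mod_eq_of_lt (by by_contra h4; exact h3 ⟨by omega, by omega⟩)]
    · rw [if_neg fun h' => h h'.1, max_eq_left (by omega), max_eq_left (by omega)]

theorem CompP.mem {B : P.Inst → ℕ} {F G : α → ℕ} (hB : LoopBound B) (hF : Comp Γ F)
    (hG : Comp Γ G) : CompP Γ fun a => Mem (B (Γ.inst a)) (F a) (G a) := by
  have hS := hB.comp Γ
  have hpow : Comp Γ fun a => 2 ^ min (B (Γ.inst a)) (B (Γ.inst a)) := Comp.two_pow_min hB hS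
  have hidx : Comp Γ.ext.ext fun a => B (Γ.inst a.1.1) - 1 - a.1.2 :=
    (hS.wk.wk.sub (Comp.const _ 1)).sub (Comp.last _).wk
  have hidx' : Comp Γ.ext.ext fun a => 2 ^ min (B (Γ.inst a.1.1) - 1 - a.1.2) (B (Γ.inst a.1.1)) :=
    Comp.two_pow_min hB hidx
  have hr := Comp.rounds (G := fun a t acc => if G a < B (Γ.inst a) - 1 - t ∧
      2 ^ min (B (Γ.inst a) - 1 - t) (B (Γ.inst a)) ≤ acc then
      acc - 2 ^ min (B (Γ.inst a) - 1 - t) (B (Γ.inst a)) else acc) hB hF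
    (Comp.ite ((CompP.lt hG.wk.wk hidx).and (CompP.le hidx' (Comp.last _)))
      ((Comp.last _).sub hidx') (Comp.last _))
  refine ((CompP.lt hF hpow).and ((CompP.lt hG hS).and
    (CompP.le (Comp.two_pow_min hB hG) hr))).congr fun a => ?_
  simp only [min_self]
  refine and_congr_right fun hT => and_congr_right fun hi => ?_
  rw [rounds_mod hT hi _ le_rfl, min_eq_left hi.le, Nat.sub_self, max_eq_left (Nat.zero_le _),
    Nat.testBit_eq_decide_div_mod_eq, decide_eq_true_iff]
  have h1 : F a % 2 ^ (G a + 1) = F a % 2 ^ G a + 2 ^ G a * (F a / 2 ^ G a % 2) := by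
    rw [pow_succ, Nat.mod_mul]
  have h2 := Nat.mod_lt (F a) (Nat.two_pow_pos (G a))
  rcases Nat.mod_two_eq_zero_or_one (F a / 2 ^ G a) with h | h <;> (rw [h1, h]; omega)

/-! ### Loop bounds -/

theorem LoopBound.add {B B' : P.Inst → ℕ} (h : LoopBound B) (h' : LoopBound B') :
    LoopBound fun x => B x + B' x :=
  ⟨h.bounded.add h'.bounded, fun Γ => (h.comp Γ).add (h'.comp Γ)⟩

theorem LoopBound.mul {B B' : P.Inst → ℕ} (h : LoopBound B) (h' : LoopBound B') :
    LoopBound fun x => B x * B' x :=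
  ⟨h.bounded.mul h'.bounded, fun Γ => (h.comp Γ).mul h'⟩

/-- Powers of two whose exponent is bounded in terms of the parameter. -/
theorem LoopBound.two_pow {B : P.Inst → ℕ} (h : LoopBound B) {f : ℕ → ℕ} (hf : Computable f)
    (hB : ∀ x, B x ≤ f (P.param x)) : LoopBound fun x => 2 ^ B x := by
  refine ⟨(FPTBounded.of_param (f := fun d => 2 ^ f d) ?_).mono fun x =>
    Nat.pow_le_pow_right (by norm_num) (hB x), fun Γ =>
    (Comp.two_pow_min h (h.comp Γ)).congr fun a => by rw [min_self]⟩
  have h2 : Primrec fun m : ℕ => 2 ^ m := by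
    refine (Primrec.nat_rec₁ 1 ((Primrec.nat_add.comp .snd .snd).to₂ :
      Primrec₂ fun _ acc : ℕ => acc + acc)).of_eq fun m => ?_
    induction m with
    | zero => rfl
    | succ m ih => rw [pow_succ, ← ih]; simp only; ring
  exact h2.to_comp.comp hf

end RAM

namespace RAM

theorem rounds_induction {init B : ℕ} {body : ℕ → ℕ → ℕ} {Q : ℕ → Prop} (h0 : Q init)
    (hs : ∀ i < B, ∀ acc, Q acc → Q (body i acc)) : Q (rounds init body B) := by
  induction B with
  | zero => exact h0
  | succ B ih =>
    exact hs B (Nat.lt_succ_self B) _ (ih fun i hi => hs i (hi.trans (Nat.lt_succ_self B)))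

/-- A property that one round establishes and that all rounds preserve holds in the end. -/
theorem rounds_of_round {init B i : ℕ} {body : ℕ → ℕ → ℕ} {Q : ℕ → Prop} (hi : i < B)
    (h0 : ∀ acc, Q (body i acc)) (hs : ∀ j acc, Q acc → Q (body j acc)) :
    Q (rounds init body B) := by
  induction B with
  | zero => omega
  | succ B ih =>
    rcases (Nat.lt_succ_iff.1 hi).lt_or_eq with h | rfl
    · exact hs _ _ (ih h)
    · exact h0 _

end RAM

namespace EqColInstance

open RAM Finset

variable (x : EqColInstance)

/-! ## The modulator -/

/-- Adjacency, on natural numbers. -/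
def adj (v w : ℕ) : Prop := ∃ (hv : v < x.n) (hw : w < x.n), x.G.Adj ⟨v, hv⟩ ⟨w, hw⟩

variable {x} in
theorem adj.symm {v w : ℕ} (h : x.adj v w) : x.adj w v :=
  let ⟨hv, hw, h⟩ := h; ⟨hw, hv, h.symm⟩

theorem adj_irrefl (v : ℕ) : ¬ x.adj v v := fun ⟨_, _, h⟩ => x.G.loopless.irrefl _ h

/-- The vertices `a`, `b`, `c` induce an edge and an isolated vertex. -/
def Obstruction (a b c : ℕ) : Prop := x.adj a b ∧ ¬ x.adj a c ∧ ¬ x.adj b c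

/-- Add an obstruction that is disjoint from the current set. -/
noncomputable def greedyStep (a b c acc : ℕ) : ℕ :=
  tab x.n fun v => Mem x.n acc v ∨
    (x.Obstruction a b c ∧ ¬ Mem x.n acc a ∧ ¬ Mem x.n acc b ∧ ¬ Mem x.n acc c) ∧
      (v = a ∨ v = b ∨ v = c)

/-- The code of the union of a maximal family of disjoint obstructions. -/
noncomputable def modCode : ℕ :=
  rounds 0 (fun a acc => rounds acc (fun b acc =>
    rounds acc (fun c acc => x.greedyStep a b c acc) x.n) x.n) x.n

/-- Membership in the modulator. -/
def InMod (v : ℕ) : Prop := Mem x.n x.modCode v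

theorem inMod_of_obstruction {a b c : ℕ} (hc : c < x.n) (h : x.Obstruction a b c) :
    x.InMod a ∨ x.InMod b ∨ x.InMod c := by
  have ha : a < x.n := h.1.1
  have hb : b < x.n := h.1.2.1
  let Q : ℕ → Prop := fun acc => Mem x.n acc a ∨ Mem x.n acc b ∨ Mem x.n acc c
  have hstep : ∀ a' b' c' acc, Q acc → Q (x.greedyStep a' b' c' acc) := by
    intro a' b' c' acc hQ
    refine hQ.imp (fun h => mem_tab.2 ⟨ha, .inl h⟩)
      (Or.imp (fun h => mem_tab.2 ⟨hb, .inl h⟩) fun h => mem_tab.2 ⟨hc, .inl h⟩)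
  have hfin : ∀ acc, Q (x.greedyStep a b c acc) := by
    intro acc
    by_cases hQ : Q acc
    · exact hstep _ _ _ _ hQ
    · simp only [Q, not_or] at hQ
      exact .inl (mem_tab.2 ⟨ha, .inr ⟨⟨h, hQ⟩, .inl rfl⟩⟩)
  have h3 : ∀ a' b' acc, Q acc → Q (rounds acc (fun c acc => x.greedyStep a' b' c acc) x.n) :=
    fun a' b' acc hQ => rounds_induction hQ fun _ _ _ => hstep _ _ _ _
  have h2 : ∀ a' acc, Q acc → Q (rounds acc (fun b acc =>
      rounds acc (fun c acc => x.greedyStep a' b c acc) x.n) x.n) :=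
    fun a' acc hQ => rounds_induction hQ fun _ _ _ => h3 _ _ _
  exact rounds_of_round (Q := Q) ha (fun _ => rounds_of_round hb (fun _ => rounds_of_round hc hfin
    fun _ _ => hstep _ _ _ _) fun _ _ => h3 _ _ _) fun _ _ => h2 _ _

theorem exists_modulator : ∃ U : Finset ℕ, U.card ≤ x.G.distToCoCluster ∧
    ∀ a b c, c < x.n → x.Obstruction a b c → a ∈ U ∨ b ∈ U ∨ c ∈ U := by
  classical
  have hne : {m | ∃ U : Finset (Fin x.n), U.card = m ∧
      (x.G.induce {v | v ∉ U}).IsCoCluster}.Nonempty := by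
    refine ⟨_, Finset.univ, rfl, fun C => ?_⟩
    induction C using SimpleGraph.ConnectedComponent.ind with
    | h v => exact absurd (Finset.mem_univ v.1) v.2
  obtain ⟨U, hU, hC⟩ := Nat.sInf_mem hne
  refine ⟨U.map Fin.valEmbedding, (by rw [card_map, hU]; rfl), ?_⟩
  rintro a b c hc ⟨⟨ha, hb, hab⟩, hac, hbc⟩
  by_contra hcon
  have key : ∀ v (hv : v < x.n), v ∉ U.map Fin.valEmbedding → (⟨v, hv⟩ : Fin x.n) ∉ U :=
    fun v hv h h' => h (Finset.mem_map.2 ⟨_, h', rfl⟩)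
  simp only [not_or] at hcon
  let a' : {v | v ∉ U} := ⟨⟨a, ha⟩, key a ha hcon.1⟩
  let b' : {v | v ∉ U} := ⟨⟨b, hb⟩, key b hb hcon.2.1⟩
  let c' : {v | v ∉ U} := ⟨⟨c, hc⟩, key c hc hcon.2.2⟩
  have hab' : x.adj a b := ⟨ha, hb, hab⟩
  have hac' : a ≠ c := by rintro rfl; exact hbc hab'.symm
  have hbc' : b ≠ c := by rintro rfl; exact hac hab'
  have h1 : ((x.G.induce {v | v ∉ U})ᶜ).Adj a' c' :=
    ⟨fun h => hac' (congrArg (fun z : {v | v ∉ U} => z.1.1) h), fun h => hac ⟨ha, hc, h⟩⟩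
  have h2 : ((x.G.induce {v | v ∉ U})ᶜ).Adj b' c' :=
    ⟨fun h => hbc' (congrArg (fun z : {v | v ∉ U} => z.1.1) h), fun h => hbc ⟨hb, hc, h⟩⟩
  have hne : a' ≠ b' := fun h => by
    have : a = b := congrArg (fun z : {v | v ∉ U} => z.1.1) h
    subst this
    exact x.adj_irrefl _ hab'
  have h3 := hC (SimpleGraph.connectedComponentMk _ c') (x := a') (y := b')
    (by simpa [SimpleGraph.ConnectedComponent.mem_supp_iff] using h1.reachable)
    (by simpa [SimpleGraph.ConnectedComponent.mem_supp_iff] using h2.reachable) hne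
  exact h3.2 hab

/-- The size of the modulator. -/
noncomputable def modSize : ℕ := count x.n x.InMod

theorem modSize_le_size : x.modSize ≤ x.n := by
  classical
  rw [modSize, count_eq_card]
  exact (card_filter_le _ _).trans (card_range _).le

theorem modSize_le : x.modSize ≤ 3 * x.G.distToCoCluster := by
  classical
  obtain ⟨U, hU, hob⟩ := x.exists_modulator
  let W : ℕ → Finset ℕ := fun acc => {v ∈ range x.n | Mem x.n acc v}
  let Q : ℕ → Prop := fun acc => (W acc).card ≤ 3 * (W acc ∩ U).card
  have hmem : ∀ acc v, v ∈ W acc ↔ Mem x.n acc v :=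
    fun acc v => by simpa [W] using fun h : Mem x.n acc v => h.2.1
  have hstep : ∀ a b c, c < x.n → ∀ acc, Q acc → Q (x.greedyStep a b c acc) := by
    intro a b c hc acc hQ
    by_cases h : x.Obstruction a b c ∧ ¬ Mem x.n acc a ∧ ¬ Mem x.n acc b ∧ ¬ Mem x.n acc c
    · have ha : a < x.n := h.1.1.1
      have hb : b < x.n := h.1.1.2.1
      have hW : W (x.greedyStep a b c acc) = W acc ∪ {a, b, c} := by
        ext v
        rw [hmem, greedyStep, mem_tab, mem_union, hmem]
        simp only [h, not_false_eq_true, and_self, true_and, mem_insert, mem_singleton]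
        constructor
        · exact fun h => h.2
        · rintro (h | rfl | rfl | rfl)
          · exact ⟨h.2.1, .inl h⟩
          all_goals simp [*]
      have hdis : Disjoint (W acc) {a, b, c} := by
        rw [disjoint_right]
        intro v hv hv'
        rw [hmem] at hv'
        simp only [mem_insert, mem_singleton] at hv
        rcases hv with rfl | rfl | rfl
        · exact h.2.1 hv'
        · exact h.2.2.1 hv'
        · exact h.2.2.2 hv'
      obtain ⟨v, hv, hvU⟩ : ∃ v ∈ ({a, b, c} : Finset ℕ), v ∈ U := by
        rcases hob a b c hc h.1 with h | h | h
        · exact ⟨a, by simp, h⟩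
        · exact ⟨b, by simp, h⟩
        · exact ⟨c, by simp, h⟩
      have hpos : 0 < (({a, b, c} : Finset ℕ) ∩ U).card := card_pos.2 ⟨v, mem_inter.2 ⟨hv, hvU⟩⟩
      have h3 : ({a, b, c} : Finset ℕ).card ≤ 3 := card_le_three
      have hQ' : (W acc).card ≤ 3 * (W acc ∩ U).card := hQ
      change (W _).card ≤ 3 * (W _ ∩ U).card
      rw [hW, card_union_of_disjoint hdis, union_inter_distrib_right,
        card_union_of_disjoint (hdis.mono inter_subset_left inter_subset_left)]
      omega
    · have hW : W (x.greedyStep a b c acc) = W acc := by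
        ext v
        rw [hmem, greedyStep, mem_tab, hmem]
        simp only [h, false_and, or_false]
        exact ⟨fun h => h.2, fun h => ⟨h.2.1, h⟩⟩
      simpa only [Q, hW] using hQ
  have h0 : Q 0 := by
    have : W 0 = ∅ := by
      ext v
      rw [hmem]
      simp [Mem]
    simp [Q, this]
  have hfin : Q x.modCode := rounds_induction h0 fun a _ acc h => rounds_induction h
    fun b _ acc h => rounds_induction h fun c hc acc h => hstep a b c hc acc h
  rw [modSize, count_eq_card]
  calc _ ≤ 3 * (W x.modCode ∩ U).card := hfin
    _ ≤ 3 * U.card := Nat.mul_le_mul_left _ (card_le_card inter_subset_right)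
    _ ≤ _ := Nat.mul_le_mul_left _ hU

/-- The number of colors that are used if there are at most as many colors as vertices. -/
def colors : ℕ := min x.k x.n

/-- The lower bound for the size of a color class. -/
def low : ℕ := x.n / x.colors

/-- The position of a vertex in the modulator. -/
noncomputable def rank (v : ℕ) : ℕ := count x.n fun w => w < v ∧ x.InMod w

/-- The number of special colors, which may occur in the modulator. -/
noncomputable def special : ℕ := min x.modSize x.colors

end EqColInstance

namespace EquitableColoringComp

open RAM EqColInstance Finset

local notation "EC" => equitableColoringByDistToCoCluster

variable {α : Type} {Γ : Ctx EC α}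

theorem le_inputSize (w : List ℕ) : w.length ≤ inputSize w := by
  induction w with
  | nil => simp
  | cons a w ih =>
    simp only [inputSize, List.map_cons, List.sum_cons, List.length_cons] at ih ⊢
    omega

theorem loopBound_n : LoopBound (P := EC) fun x => EqColInstance.n x :=
  ⟨.of_size fun x => (by
    refine le_trans ?_ (le_inputSize _)
    simp only [equitableColoringByDistToCoCluster, encode, List.length_cons, List.length_ofFn]
    nlinarith [Nat.le_mul_self (EqColInstance.n x)]),
    fun Γ => (Comp.const Γ 0).read.congr fun a => rfl⟩

theorem inputSize_pos (x : EqColInstance) : 0 < inputSize x.encode :=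
  lt_of_lt_of_le (by simp [encode]) (le_inputSize _)

theorem compP_adj {F G : α → ℕ} (hF : Comp Γ F) (hG : Comp Γ G) :
    CompP Γ fun a => EqColInstance.adj (Γ.inst a) (F a) (G a) := by
  have hn := loopBound_n.comp Γ
  refine ((CompP.lt hF hn).and ((CompP.lt hG hn).and
    (((Comp.const Γ 2).add ((hF.mul loopBound_n).add hG)).read.ne_zero))).congr fun a => ?_
  generalize Γ.inst a = x
  change EqColInstance at x
  constructor
  · rintro ⟨h1, h2, h3⟩
    have hlt : F a * x.n + G a < x.n * x.n := by nlinarith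
    have h4 : ((x.encode).getD (2 + (F a * x.n + G a)) 0) ≠ 0 := h3
    rw [add_comm, encode, List.getD_cons_succ, List.getD_cons_succ,
      List.getD_eq_getElem _ _ (by simpa)] at h4
    simp only [List.getElem_ofFn, ne_eq, ite_eq_right_iff, one_ne_zero, imp_false, not_not] at h4
    refine ⟨h1, h2, ?_⟩
    convert h4 using 1
    · ext; simp [Fin.divNat]; rw [mul_comm, Nat.mul_add_div (by omega), Nat.div_eq_of_lt h2]; simp
    · ext; simp [Fin.modNat]; rw [Nat.mod_eq_of_lt h2]
  · rintro ⟨h1, h2, h3⟩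
    refine ⟨h1, h2, ?_⟩
    have hlt : F a * x.n + G a < x.n * x.n := by nlinarith
    change ((x.encode).getD (2 + (F a * x.n + G a)) 0) ≠ 0
    rw [add_comm, encode, List.getD_cons_succ, List.getD_cons_succ,
      List.getD_eq_getElem _ _ (by simpa)]
    simp only [List.getElem_ofFn, ne_eq, ite_eq_right_iff, one_ne_zero, imp_false, not_not]
    convert h3 using 1
    · ext; simp [Fin.divNat]; rw [mul_comm, Nat.mul_add_div (by omega), Nat.div_eq_of_lt h2]; simp
    · ext; simp [Fin.modNat]; rw [Nat.mod_eq_of_lt h2]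

theorem comp_modCode (Γ : Ctx EC α) : Comp Γ fun a => modCode (Γ.inst a) := by
  have hstep : ∀ {β : Type} (Δ : Ctx EC β) {A B C D : β → ℕ}, Comp Δ A → Comp Δ B → Comp Δ C →
      Comp Δ D → Comp Δ fun a => greedyStep (Δ.inst a) (A a) (B a) (C a) (D a) := by
    intro β Δ A B C D hA hB hC hD
    have hm : ∀ {β : Type} {Δ : Ctx EC β} {A D : β → ℕ}, Comp Δ A → Comp Δ D →
        CompP Δ fun a => Mem (EqColInstance.n (Δ.inst a)) (D a) (A a) :=
      fun hA hD => CompP.mem loopBound_n hD hA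
    have hob : CompP Δ fun a => Obstruction (Δ.inst a) (A a) (B a) (C a) :=
      (compP_adj hA hB).and ((compP_adj hA hC).not.and (compP_adj hB hC).not)
    exact Comp.tab loopBound_n ((hm (Comp.last _) hD.wk).or
      (((hob.and ((hm hA hD).not.and ((hm hB hD).not.and (hm hC hD).not))).wk).and
        ((CompP.eq (Comp.last _) hA.wk).or
          ((CompP.eq (Comp.last _) hB.wk).or (CompP.eq (Comp.last _) hC.wk)))))
  exact Comp.rounds (G := fun a i acc => _) loopBound_n (Comp.const Γ 0)
    (Comp.rounds (Γ := Γ.ext.ext) (G := fun a i acc => _) loopBound_n (Comp.last _)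
      (Comp.rounds (Γ := Γ.ext.ext.ext.ext) (G := fun a i acc => _) loopBound_n (Comp.last _)
        (hstep Γ.ext.ext.ext.ext.ext.ext (Comp.last _).wk.wk.wk.wk.wk (Comp.last _).wk.wk.wk
          (Comp.last _).wk (Comp.last _))))

theorem compP_inMod {F : α → ℕ} (hF : Comp Γ F) :
    CompP Γ fun a => InMod (Γ.inst a) (F a) :=
  CompP.mem loopBound_n (comp_modCode Γ) hF

theorem loopBound_modSize : LoopBound (P := EC) fun x => modSize x :=
  ⟨loopBound_n.bounded.mono modSize_le_size, fun Γ =>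
    Comp.count (p := fun a v => InMod (Γ.inst a) v) loopBound_n (compP_inMod (Γ := Γ.ext) (Comp.last _))⟩

theorem comp_rank {F : α → ℕ} (hF : Comp Γ F) : Comp Γ fun a => rank (Γ.inst a) (F a) :=
  Comp.count (p := fun a w => w < F a ∧ InMod (Γ.inst a) w) loopBound_n
    ((CompP.lt (Comp.last _) hF.wk).and (compP_inMod (Γ := Γ.ext) (Comp.last _)))

theorem loopBound_colors : LoopBound (P := EC) fun x => colors x :=
  ⟨loopBound_n.bounded.mono fun x => min_le_right _ _, fun Γ => by
    have hk : Comp Γ fun a => EqColInstance.k (Γ.inst a) := (Comp.const Γ 1).read.congr fun a => rfl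
    exact (hk.sub (hk.sub (loopBound_n.comp Γ))).congr fun a => Nat.sub_sub_eq_min _ _⟩

theorem loopBound_special : LoopBound (P := EC) fun x => special x :=
  ⟨loopBound_modSize.bounded.mono fun x => min_le_left _ _, fun Γ => by
    have hk := loopBound_modSize.comp Γ
    exact (hk.sub (hk.sub (loopBound_colors.comp Γ))).congr fun a => Nat.sub_sub_eq_min _ _⟩

theorem count_lt_of_le (n m : ℕ) (h : m ≤ n) : count n (fun i => i < m) = m := by
  rw [count_eq_card]
  have : {i ∈ range n | i < m} = range m := by ext; simp; omega
  rw [this, card_range]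

theorem loopBound_low : LoopBound (P := EC) fun x => low x :=
  ⟨loopBound_n.bounded.mono fun x => Nat.div_le_self _ _, fun Γ => by
    refine (Comp.count (p := fun a i => (i + 1) * colors (Γ.inst a) ≤ EqColInstance.n (Γ.inst a) ∧
      colors (Γ.inst a) ≠ 0) loopBound_n
      ((CompP.le (Comp.mul (Γ := Γ.ext) ((Comp.last _).add (Comp.const _ 1)) loopBound_colors)
        (loopBound_n.comp _)).and (loopBound_colors.comp _).ne_zero)).congr fun a => ?_
    generalize Γ.inst a = x
    change EqColInstance at x
    rw [low, ← count_lt_of_le x.n (x.n / x.colors) (Nat.div_le_self _ _)]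
    congr 1
    ext i
    rcases Nat.eq_zero_or_pos x.colors with h | h
    · simp [h]
    · rw [← Nat.succ_le_iff (m := i), Nat.le_div_iff_mul_le h]
      simp [h.ne']⟩

theorem loopBound_two_pow_special : LoopBound (P := EC) fun x => 2 ^ special x :=
  loopBound_special.two_pow (f := fun d => 3 * d)
    ((Primrec.nat_mul.comp (Primrec.const 3) Primrec.id).to_comp)
    fun x => (min_le_left _ _).trans (modSize_le x)

theorem loopBound_two_pow_modSize_sq : LoopBound (P := EC) fun x => 2 ^ (modSize x * modSize x) :=
  (loopBound_modSize.mul loopBound_modSize).two_pow (f := fun d => (3 * d) * (3 * d))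
    ((Primrec.nat_mul.comp (Primrec.nat_mul.comp (Primrec.const 3) Primrec.id)
      (Primrec.nat_mul.comp (Primrec.const 3) Primrec.id)).to_comp)
    fun x => Nat.mul_le_mul (modSize_le x) (modSize_le x)

end EquitableColoringComp

/-! ## Distributing vertices over color classes -/

namespace Finset

open Classical in
/-- Disjoint sets of prescribed sizes inside given sets exist under Hall's condition. -/
theorem exists_disjoint_subsets {S : Finset ℕ} {avail : ℕ → Finset ℕ} {dem : ℕ → ℕ}
    (h : ∀ T ⊆ S, ∑ j ∈ T, dem j ≤ #(T.biUnion avail)) :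
    ∃ B : ℕ → Finset ℕ, (∀ j ∈ S, B j ⊆ avail j ∧ #(B j) = dem j) ∧
      ∀ j ∈ S, ∀ j' ∈ S, ∀ w, w ∈ B j → w ∈ B j' → j = j' := by
  let ι := Σ j : S, Fin (dem j)
  obtain ⟨f, hf, hmem⟩ := (Finset.all_card_le_biUnion_card_iff_exists_injective
    (fun i : ι => avail i.1)).1 (by
      intro s
      let T : Finset ℕ := s.image fun i => (i.1 : ℕ)
      have hT : T ⊆ S := by
        intro j hj
        obtain ⟨i, -, rfl⟩ := mem_image.1 hj
        exact i.1.2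
      have h1 : s.biUnion (fun i : ι => avail i.1) = T.biUnion avail := by
        ext w; simp [T, image_biUnion]
      rw [h1]
      refine le_trans ?_ (h T hT)
      rw [card_eq_sum_card_fiberwise (f := fun i : ι => (i.1 : ℕ)) (t := T)
        (fun i hi => mem_image_of_mem _ hi)]
      refine sum_le_sum fun j hj => ?_
      obtain ⟨i₀, -, rfl⟩ := mem_image.1 hj
      have : ({i ∈ s | (i.1 : ℕ) = i₀.1} : Finset ι) ⊆
          (univ : Finset (Fin (dem i₀.1))).image fun q => (⟨i₀.1, q⟩ : ι) := by
        rintro ⟨j, q⟩ hi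
        have hj := (mem_filter.1 hi).2
        obtain rfl : j = i₀.1 := Subtype.ext hj
        exact mem_image.2 ⟨q, mem_univ _, rfl⟩
      exact (card_le_card this).trans (card_image_le.trans (by simp)))
  refine ⟨fun j => if hj : j ∈ S then (univ : Finset (Fin (dem j))).image fun q => f ⟨⟨j, hj⟩, q⟩
    else ∅, fun j hj => ⟨?_, ?_⟩, fun j hj j' hj' w hw hw' => ?_⟩
  · intro w hw
    simp only [hj, dif_pos, mem_image] at hw
    obtain ⟨q, -, rfl⟩ := hw
    exact hmem ⟨⟨j, hj⟩, q⟩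
  · simp only [hj, dif_pos]
    have hinj : Function.Injective fun q : Fin (dem j) => f ⟨⟨j, hj⟩, q⟩ :=
      fun q q' h => eq_of_heq (Sigma.mk.inj_iff.1 (hf h)).2
    rw [card_image_of_injective _ hinj]
    simp
  · simp only [hj, hj', dif_pos, mem_image] at hw hw'
    obtain ⟨q, -, rfl⟩ := hw
    obtain ⟨q', -, h'⟩ := hw'
    have := congrArg (fun i : ι => (i.1 : ℕ)) (hf h')
    exact this.symm

/-- A set can be split into `c` classes of size `s` or `s + 1` if its size permits. -/
theorem exists_balanced_map (s c : ℕ) (R : Finset ℕ) (h1 : c * s ≤ #R) (h2 : #R ≤ c * (s + 1)) :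
    ∃ ψ : ℕ → ℕ, (∀ w ∈ R, ψ w < c) ∧ ∀ j < c, s ≤ #{w ∈ R | ψ w = j} ∧
      #{w ∈ R | ψ w = j} ≤ s + 1 := by
  induction c generalizing R with
  | zero =>
    have hR : R = ∅ := by simpa using h2
    exact ⟨id, by simp [hR], by simp⟩
  | succ c ih =>
    obtain ⟨m, hm1, hm2, hm3, hm4, hm5⟩ : ∃ m, s ≤ m ∧ m ≤ s + 1 ∧ m ≤ #R ∧ c * s ≤ #R - m ∧
        #R - m ≤ c * (s + 1) := by
      rw [Nat.add_mul, one_mul] at h1 h2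
      by_cases h : #R - s ≤ c * (s + 1)
      · exact ⟨s, le_rfl, by omega, by omega, by omega, h⟩
      · have : c * s ≤ c * (s + 1) := Nat.mul_le_mul_left c (Nat.le_succ s)
        exact ⟨s + 1, by omega, le_rfl, by omega, by omega, by omega⟩
    obtain ⟨A, hA, hAm⟩ := exists_subset_card_eq hm3
    have hcard : #(R \ A) = #R - m := by rw [card_sdiff_of_subset hA, hAm]
    obtain ⟨ψ, hψ, hψ'⟩ := ih (R \ A) (hcard ▸ hm4) (hcard ▸ hm5)
    have hlt : ∀ w ∈ R, w ∉ A → ψ w < c := fun w hw hA => hψ w (mem_sdiff.2 ⟨hw, hA⟩)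
    refine ⟨fun w => if w ∈ A then c else ψ w, fun w hw => ?_, fun j hj => ?_⟩
    · by_cases hwA : w ∈ A
      · simp [hwA]
      · simp only [hwA, if_false]; exact (hlt w hw hwA).trans (Nat.lt_succ_self c)
    · rcases (Nat.lt_succ_iff.1 hj).lt_or_eq with h | rfl
      · have : {w ∈ R | (if w ∈ A then c else ψ w) = j} = {w ∈ R \ A | ψ w = j} := by
          ext w
          by_cases hwA : w ∈ A <;> simp [hwA, h.ne']
        rw [this]
        exact hψ' j h
      · have : {w ∈ R | (if w ∈ A then j else ψ w) = j} = A := by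
          ext w
          by_cases hwA : w ∈ A
          · simp [hwA, hA hwA]
          · simpa [hwA] using fun hw => (hlt w hw hwA).ne
        rw [this, hAm]
        exact ⟨hm1, hm2⟩

end Finset

namespace EqColInstance

open RAM Finset

variable (x : EqColInstance)

open Classical in
/-- The part of `G - U` that contains the vertex `i`. -/
noncomputable def part (i : ℕ) : Finset ℕ := {w ∈ range x.n | ¬ x.InMod w ∧ ¬ x.adj i w}

/-- The vertex `i` is the first vertex of its part. -/
def IsRep (i : ℕ) : Prop := ¬ x.InMod i ∧ ∀ w < x.n, w < i → ¬ x.InMod w → x.adj i w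

open Classical in
/-- The vertices of the modulator with color `j`. -/
noncomputable def modClass (γ : ℕ → ℕ) (j : ℕ) : Finset ℕ := {v ∈ range x.n | x.InMod v ∧ γ v = j}

/-- The number of vertices missing in the class of a special color with target size `τ j`. -/
noncomputable def demand (γ τ : ℕ → ℕ) (j : ℕ) : ℕ := τ j - #(x.modClass γ j)

open Classical in
/-- The vertices of the part of `i` that may receive the color `j`. -/
noncomputable def avail (γ : ℕ → ℕ) (i j : ℕ) : Finset ℕ :=
  {w ∈ x.part i | ∀ v ∈ x.modClass γ j, ¬ x.adj w v}

/-- The part of `i` can be colored by the special colors in `S` and `c` other colors. -/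
def Feasible (γ τ : ℕ → ℕ) (i : ℕ) (S : Finset ℕ) (c : ℕ) : Prop :=
  (∀ T ⊆ S, ∑ j ∈ T, x.demand γ τ j ≤ #(T.biUnion (x.avail γ i))) ∧
    c * x.low + ∑ j ∈ S, x.demand γ τ j ≤ #(x.part i) ∧
    #(x.part i) ≤ c * (x.low + 1) + ∑ j ∈ S, x.demand γ τ j

/-- The parts with a representative below `t` can be colored such that exactly the special colors
in `S` and `c` other colors are complete. -/
def Reach (γ τ : ℕ → ℕ) : ℕ → Finset ℕ → ℕ → Prop
  | 0, S, c => S = ∅ ∧ c = 0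
  | t + 1, S, c => (¬ x.IsRep t ∧ Reach γ τ t S c) ∨
      (x.IsRep t ∧ ∃ S₀ ⊆ S, ∃ c₀ ≤ c, Reach γ τ t S₀ c₀ ∧ x.Feasible γ τ t (S \ S₀) (c - c₀))

/-- A coloring of the modulator together with target sizes for the special colors. -/
structure Valid (γ τ : ℕ → ℕ) : Prop where
  lt : ∀ v, x.InMod v → γ v < x.special
  proper : ∀ v w, x.InMod v → x.InMod w → x.adj v w → γ v ≠ γ w
  low_le : ∀ j < x.special, x.low ≤ τ j
  le_succ : ∀ j < x.special, τ j ≤ x.low + 1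
  card_le : ∀ j < x.special, #(x.modClass γ j) ≤ τ j

/-- There is a coloring whose classes have size `low` or `low + 1`. -/
def BalancedColorable : Prop :=
  ∃ φ : ℕ → ℕ, (∀ v < x.n, φ v < x.colors) ∧ (∀ v w, x.adj v w → φ v ≠ φ w) ∧
    ∀ j < x.colors, x.low ≤ #{v ∈ range x.n | φ v = j} ∧ #{v ∈ range x.n | φ v = j} ≤ x.low + 1

variable {x}

theorem InMod.lt {v : ℕ} (h : x.InMod v) : v < x.n := h.2.1

theorem mem_part {i w : ℕ} : w ∈ x.part i ↔ w < x.n ∧ ¬ x.InMod w ∧ ¬ x.adj i w := by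
  simp [part]

theorem mem_modClass {γ : ℕ → ℕ} {j v : ℕ} : v ∈ x.modClass γ j ↔ x.InMod v ∧ γ v = j := by
  simpa [modClass] using fun h _ => InMod.lt h

theorem not_adj_trans {a b c : ℕ} (ha : ¬ x.InMod a) (hb : ¬ x.InMod b) (hc : ¬ x.InMod c)
    (hcn : c < x.n) (hac : ¬ x.adj a c) (hbc : ¬ x.adj b c) : ¬ x.adj a b := fun hab => by
  rcases x.inMod_of_obstruction hcn ⟨hab, hac, hbc⟩ with h | h | h
  · exact ha h
  · exact hb h
  · exact hc h

theorem not_adj_of_mem_part {i v w : ℕ} (hi : ¬ x.InMod i) (hin : i < x.n) (hv : v ∈ x.part i)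
    (hw : w ∈ x.part i) : ¬ x.adj v w :=
  not_adj_trans (mem_part.1 hv).2.1 (mem_part.1 hw).2.1 hi hin
    (fun h => (mem_part.1 hv).2.2 h.symm) fun h => (mem_part.1 hw).2.2 h.symm

theorem exists_rep {v : ℕ} (hv : v < x.n) (hvM : ¬ x.InMod v) :
    ∃ i < x.n, x.IsRep i ∧ v ∈ x.part i := by
  classical
  have hne : (x.part v).Nonempty := ⟨v, mem_part.2 ⟨hv, hvM, x.adj_irrefl v⟩⟩
  have hmin := mem_part.1 ((x.part v).min'_mem hne)
  refine ⟨(x.part v).min' hne, hmin.1, ⟨hmin.2.1, fun w hw hlt hwM => ?_⟩,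
    mem_part.2 ⟨hv, hvM, fun h => hmin.2.2 h.symm⟩⟩
  by_contra hadj
  refine absurd ((x.part v).min'_le w (mem_part.2 ⟨hw, hwM, ?_⟩)) (not_le.2 hlt)
  exact not_adj_trans hvM hwM hmin.2.1 hmin.1 hmin.2.2 fun h => hadj h.symm

/-- Nonadjacent vertices of two parts with different representatives do not exist. -/
theorem rep_unique {i i' v w : ℕ} (hi : x.IsRep i) (hi' : x.IsRep i') (hin : i < x.n)
    (hin' : i' < x.n) (hv : v ∈ x.part i) (hw : w ∈ x.part i') (hvw : ¬ x.adj v w) : i = i' := by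
  have hv' := mem_part.1 hv
  have hw' := mem_part.1 hw
  have h1 : ¬ x.adj i w := not_adj_trans hi.1 hw'.2.1 hv'.2.1 hv'.1 hv'.2.2 fun h => hvw h.symm
  have h2 : ¬ x.adj i i' := not_adj_trans hi.1 hi'.1 hw'.2.1 hw'.1 h1 hw'.2.2
  rcases lt_trichotomy i i' with h | h | h
  · exact absurd (hi'.2 i hin h hi.1).symm h2
  · exact h
  · exact absurd (hi.2 i' hin' h hi'.1) h2

/-- Coloring one part. -/
theorem Feasible.exists_coloring {γ τ : ℕ → ℕ} {i c b : ℕ} {S : Finset ℕ}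
    (h : x.Feasible γ τ i S c) (hS : ∀ j ∈ S, j < b) :
    ∃ ψ : ℕ → ℕ, (∀ w ∈ x.part i, ψ w ∈ S ∨ (b ≤ ψ w ∧ ψ w < b + c)) ∧
      (∀ j ∈ S, #{w ∈ x.part i | ψ w = j} = x.demand γ τ j ∧
        ∀ w ∈ x.part i, ψ w = j → ∀ v ∈ x.modClass γ j, ¬ x.adj w v) ∧
      ∀ j, b ≤ j → j < b + c →
        x.low ≤ #{w ∈ x.part i | ψ w = j} ∧ #{w ∈ x.part i | ψ w = j} ≤ x.low + 1 := by
  classical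
  obtain ⟨hall, h1, h2⟩ := h
  obtain ⟨B, hB, hdis⟩ := exists_disjoint_subsets hall
  have hBsub : ∀ j ∈ S, B j ⊆ x.part i := fun j hj => (hB j hj).1.trans (filter_subset _ _)
  have hcardB : #(S.biUnion B) = ∑ j ∈ S, x.demand γ τ j := by
    rw [card_biUnion fun j hj j' hj' hne => disjoint_left.2 fun w hw hw' =>
      hne (hdis j hj j' hj' w hw hw')]
    exact sum_congr rfl fun j hj => (hB j hj).2
  have hsub : S.biUnion B ⊆ x.part i := biUnion_subset.2 hBsub
  have hR : #(x.part i \ S.biUnion B) = #(x.part i) - ∑ j ∈ S, x.demand γ τ j := by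
    rw [card_sdiff_of_subset hsub, hcardB]
  obtain ⟨ψ, hψ, hψ'⟩ := exists_balanced_map x.low c (x.part i \ S.biUnion B)
    (by rw [hR]; omega) (by rw [hR]; omega)
  have hex : ∀ w, w ∈ S.biUnion B → ∃ j ∈ S, w ∈ B j := fun w hw => by simpa using hw
  choose! κ hκS hκB using hex
  have hκ : ∀ j ∈ S, ∀ w ∈ B j, κ w = j := fun j hj w hw =>
    have hw' : w ∈ S.biUnion B := mem_biUnion.2 ⟨j, hj, hw⟩
    hdis _ (hκS w hw') _ hj w (hκB w hw') hw
  have hψR : ∀ w ∈ x.part i, w ∉ S.biUnion B → ψ w < c :=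
    fun w hw hw' => hψ w (mem_sdiff.2 ⟨hw, hw'⟩)
  have hfib : ∀ j ∈ S, {w ∈ x.part i | (if w ∈ S.biUnion B then κ w else b + ψ w) = j} = B j := by
    intro j hj
    ext w
    rw [mem_filter]
    constructor
    · rintro ⟨hw, hwj⟩
      split_ifs at hwj with h
      · exact hwj ▸ hκB w h
      · have := hS j hj; omega
    · intro hw
      rw [if_pos (mem_biUnion.2 ⟨j, hj, hw⟩)]
      exact ⟨hBsub j hj hw, hκ j hj w hw⟩
  refine ⟨fun w => if w ∈ S.biUnion B then κ w else b + ψ w, fun w hw => ?_, fun j hj => ⟨?_, ?_⟩,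
    fun j hj hj' => ?_⟩
  · by_cases h : w ∈ S.biUnion B
    · simp only [h, if_true]; exact .inl (hκS w h)
    · simp only [h, if_false]; have := hψR w hw h; right; omega
  · rw [hfib j hj]; exact (hB j hj).2
  · intro w hw hwj
    have : w ∈ B j := by rw [← hfib j hj]; exact mem_filter.2 ⟨hw, hwj⟩
    exact (mem_filter.1 ((hB j hj).1 this)).2
  · have : {w ∈ x.part i | (if w ∈ S.biUnion B then κ w else b + ψ w) = j} =
        {w ∈ x.part i \ S.biUnion B | ψ w = j - b} := by
      ext w
      rw [mem_filter, mem_filter, mem_sdiff]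
      constructor
      · rintro ⟨hw, hwj⟩
        split_ifs at hwj with h
        · have := hS _ (hκS w h); omega
        · exact ⟨⟨hw, h⟩, by omega⟩
      · rintro ⟨⟨hw, h⟩, hwj⟩
        rw [if_neg h]
        exact ⟨hw, by omega⟩
    rw [this]
    exact hψ' _ (by omega)

/-- The vertices colored when the parts with a representative below `t` are colored. -/
def Colored (x : EqColInstance) (t v : ℕ) : Prop :=
  x.InMod v ∨ ∃ i < t, i < x.n ∧ x.IsRep i ∧ v ∈ x.part i

theorem Colored.lt {t v : ℕ} (h : x.Colored t v) : v < x.n := by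
  rcases h with h | ⟨i, -, -, -, h⟩
  · exact h.lt
  · exact (mem_part.1 h).1

open Classical in
/-- A partial coloring as produced by the dynamic program. -/
structure PartialColoring (x : EqColInstance) (γ τ : ℕ → ℕ) (t : ℕ) (S : Finset ℕ) (c : ℕ)
    (φ : ℕ → ℕ) : Prop where
  eq_mod : ∀ v, x.InMod v → φ v = γ v
  lt : ∀ v, x.Colored t v → φ v < x.special + c
  proper : ∀ v w, x.Colored t v → x.Colored t w → x.adj v w → φ v ≠ φ w
  card_special : ∀ j ∈ S, #{v ∈ range x.n | x.Colored t v ∧ φ v = j} = τ j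
  inMod : ∀ j < x.special, j ∉ S → ∀ v, x.Colored t v → φ v = j → x.InMod v
  card_regular : ∀ j, x.special ≤ j → j < x.special + c →
    x.low ≤ #{v ∈ range x.n | x.Colored t v ∧ φ v = j} ∧
      #{v ∈ range x.n | x.Colored t v ∧ φ v = j} ≤ x.low + 1

theorem Reach.exists_coloring {γ τ : ℕ → ℕ} (hval : x.Valid γ τ) :
    ∀ {t : ℕ} {S : Finset ℕ} {c : ℕ}, t ≤ x.n → (∀ j ∈ S, j < x.special) → x.Reach γ τ t S c →
      ∃ φ, x.PartialColoring γ τ t S c φ := by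
  classical
  intro t
  induction t with
  | zero =>
    rintro S c - - ⟨rfl, rfl⟩
    have hc : ∀ v, x.Colored 0 v → x.InMod v := by
      rintro v (h | ⟨i, hi, -⟩)
      · exact h
      · omega
    exact ⟨γ, fun _ _ => rfl, fun v hv => hval.lt v (hc v hv),
      fun v w hv hw => hval.proper v w (hc v hv) (hc w hw), by simp, fun _ _ _ v hv _ => hc v hv,
      fun j hj hj' => by omega⟩
  | succ t ih =>
    rintro S c ht hS (⟨hrep, hR⟩ | ⟨hrep, S₀, hS₀, c₀, hc₀, hR, hfeas⟩)
    · obtain ⟨φ, h⟩ := ih (by omega) hS hR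
      have hcol : x.Colored (t + 1) = x.Colored t := by
        ext v
        refine or_congr_right ⟨?_, ?_⟩
        · rintro ⟨i, hi, hin, hir, hv⟩
          refine ⟨i, ?_, hin, hir, hv⟩
          rcases (Nat.lt_succ_iff.1 hi).lt_or_eq with h | rfl
          · exact h
          · exact absurd hir hrep
        · rintro ⟨i, hi, h⟩
          exact ⟨i, by omega, h⟩
      exact ⟨φ, by constructor <;> (try simp only [hcol]) <;> first
        | exact h.eq_mod | exact h.lt | exact h.proper | exact h.card_special | exact h.inMod
        | exact h.card_regular⟩
    · obtain ⟨φ, h⟩ := ih (by omega) (fun j hj => hS j (hS₀ hj)) hR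
      have htn : t < x.n := by omega
      obtain ⟨ψ, hψ, hψS, hψc⟩ := hfeas.exists_coloring (b := x.special + c₀)
        fun j hj => Nat.lt_add_right _ (hS j (mem_sdiff.1 hj).1)
      have hcol : ∀ v, x.Colored (t + 1) v ↔ x.Colored t v ∨ v ∈ x.part t := by
        intro v
        constructor
        · rintro (hv | ⟨i, hi, hin, hir, hv⟩)
          · exact .inl (.inl hv)
          · rcases (Nat.lt_succ_iff.1 hi).lt_or_eq with h | rfl
            · exact .inl (.inr ⟨i, h, hin, hir, hv⟩)
            · exact .inr hv
        · rintro ((hv | ⟨i, hi, h⟩) | hv)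
          · exact .inl hv
          · exact .inr ⟨i, by omega, h⟩
          · exact .inr ⟨t, by omega, htn, hrep, hv⟩
      have hdis : ∀ v, x.Colored t v → v ∉ x.part t := by
        rintro v (hv | ⟨i, hi, hin, hir, hv⟩) hv'
        · exact (mem_part.1 hv').2.1 hv
        · exact hi.ne (rep_unique hir hrep hin htn hv hv' (x.adj_irrefl v))
      let φ' : ℕ → ℕ := fun v => if v ∈ x.part t then ψ v else φ v
      have hin : ∀ v ∈ x.part t, φ' v = ψ v := fun v hv => if_pos hv
      have hout : ∀ v, x.Colored t v → φ' v = φ v := fun v hv => if_neg (hdis v hv)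
      have hcard : ∀ j, #{v ∈ range x.n | x.Colored (t + 1) v ∧ φ' v = j} =
          #{v ∈ range x.n | x.Colored t v ∧ φ v = j} + #{v ∈ x.part t | ψ v = j} := by
        intro j
        rw [← card_union_of_disjoint]
        · congr 1
          ext v
          simp only [mem_filter, mem_union, mem_range, hcol]
          constructor
          · rintro ⟨hv, hv1 | hv1, hv2⟩
            · exact .inl ⟨hv, hv1, by rw [← hv2, hout v hv1]⟩
            · exact .inr ⟨hv1, by rw [← hv2, hin v hv1]⟩
          · rintro (⟨hv, hv1, hv2⟩ | ⟨hv1, hv2⟩)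
            · exact ⟨hv, .inl hv1, by rw [hout v hv1, hv2]⟩
            · exact ⟨(mem_part.1 hv1).1, .inr hv1, by rw [hin v hv1, hv2]⟩
        · refine disjoint_left.2 fun v hv hv' => ?_
          exact hdis v (mem_filter.1 hv).2.1 (mem_filter.1 hv').1
      have hmixed : ∀ v w, x.Colored t v → w ∈ x.part t → x.adj v w → φ' v ≠ φ' w := by
        intro v w hv hw hvw heq
        rw [hout v hv, hin w hw] at heq
        rcases hψ w hw with hj | ⟨hj, -⟩
        · have hj' := mem_sdiff.1 hj
          have hvM := h.inMod _ (hS _ hj'.1) hj'.2 v hv heq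
          exact (hψS _ hj).2 w hw rfl v (mem_modClass.2 ⟨hvM, by rw [← h.eq_mod v hvM, heq]⟩)
            hvw.symm
        · have := h.lt v hv; omega
      have hpart0 : ∀ j, j ∉ S \ S₀ → (j < x.special + c₀ ∨ x.special + c ≤ j) →
          #{v ∈ x.part t | ψ v = j} = 0 := by
        intro j hj hj'
        rw [card_eq_zero, filter_eq_empty_iff]
        rintro v hv rfl
        rcases hψ v hv with h | ⟨h1, h2⟩
        · exact hj h
        · omega
      refine ⟨φ', fun v hv => ?_, fun v hv => ?_, fun v w hv hw hvw => ?_, fun j hj => ?_,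
        fun j hj hjS v hv hvj => ?_, fun j hj hj' => ?_⟩
      · rw [hout v (.inl hv), h.eq_mod v hv]
      · rcases (hcol v).1 hv with hv | hv
        · rw [hout v hv]; have := h.lt v hv; omega
        · rw [hin v hv]
          rcases hψ v hv with hj | hj
          · have := hS _ (mem_sdiff.1 hj).1; omega
          · omega
      · rcases (hcol v).1 hv with hv | hv <;> rcases (hcol w).1 hw with hw | hw
        · rw [hout v hv, hout w hw]; exact h.proper v w hv hw hvw
        · exact hmixed v w hv hw hvw
        · exact (hmixed w v hw hv hvw.symm).symm
        · exact absurd hvw (not_adj_of_mem_part hrep.1 htn hv hw)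
      · rw [hcard]
        by_cases hj0 : j ∈ S₀
        · rw [h.card_special j hj0, hpart0 j (fun h => (mem_sdiff.1 h).2 hj0)
            (.inl (Nat.lt_add_right _ (hS j hj))), add_zero]
        · rw [(hψS j (mem_sdiff.2 ⟨hj, hj0⟩)).1]
          have : {v ∈ range x.n | x.Colored t v ∧ φ v = j} = x.modClass γ j := by
            ext v
            rw [mem_filter, mem_range, mem_modClass]
            constructor
            · rintro ⟨-, hv, hvj⟩
              have hvM := h.inMod j (hS j hj) hj0 v hv hvj
              exact ⟨hvM, by rw [← h.eq_mod v hvM, hvj]⟩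
            · rintro ⟨hv, hvj⟩
              exact ⟨hv.lt, .inl hv, by rw [h.eq_mod v hv, hvj]⟩
          rw [this, demand]
          have := hval.card_le j (hS j hj)
          omega
      · rcases (hcol v).1 hv with hv | hv
        · rw [hout v hv] at hvj
          exact h.inMod j hj (fun h => hjS (hS₀ h)) v hv hvj
        · rw [hin v hv] at hvj
          rcases hψ v hv with h | h
          · exact absurd (mem_sdiff.1 (hvj ▸ h)).1 hjS
          · omega
      · rw [hcard]
        by_cases hjc : j < x.special + c₀
        · rw [hpart0 j (fun h => by have := hS j (mem_sdiff.1 h).1; omega) (.inl hjc), add_zero]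
          exact h.card_regular j hj hjc
        · have : #{v ∈ range x.n | x.Colored t v ∧ φ v = j} = 0 := by
            rw [card_eq_zero, filter_eq_empty_iff]
            rintro v - ⟨hv, rfl⟩
            exact hjc (h.lt v hv)
          rw [this, zero_add]
          exact hψc j (by omega) (by omega)

theorem balancedColorable_of_reach {γ τ : ℕ → ℕ} (hval : x.Valid γ τ) {S : Finset ℕ}
    (hS : ∀ j ∈ S, j < x.special) (hdem : ∀ j < x.special, 0 < x.demand γ τ j → j ∈ S)
    (h : x.Reach γ τ x.n S (x.colors - x.special)) : x.BalancedColorable := by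
  classical
  obtain ⟨φ, h⟩ := h.exists_coloring hval le_rfl hS
  have hcol : ∀ v < x.n, x.Colored x.n v := fun v hv => by
    by_cases hM : x.InMod v
    · exact .inl hM
    · obtain ⟨i, hi, hir, hv⟩ := exists_rep hv hM
      exact .inr ⟨i, hi, hi, hir, hv⟩
  have hps : x.special ≤ x.colors := min_le_right _ _
  have hfilter : ∀ j, {v ∈ range x.n | φ v = j} = {v ∈ range x.n | x.Colored x.n v ∧ φ v = j} :=
    fun j => filter_congr fun v hv => by simp [hcol v (mem_range.1 hv)]
  refine ⟨φ, fun v hv => ?_, fun v w hvw => ?_, fun j hj => ?_⟩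
  · have := h.lt v (hcol v hv); omega
  · exact h.proper v w (hcol v hvw.1) (hcol w hvw.2.1) hvw
  · rw [hfilter]
    by_cases hjs : j < x.special
    · by_cases hjS : j ∈ S
      · rw [h.card_special j hjS]
        exact ⟨hval.low_le j hjs, hval.le_succ j hjs⟩
      · have : {v ∈ range x.n | x.Colored x.n v ∧ φ v = j} = x.modClass γ j := by
          ext v
          rw [mem_filter, mem_range, mem_modClass]
          constructor
          · rintro ⟨-, hv, hvj⟩
            have hvM := h.inMod j hjs hjS v hv hvj
            exact ⟨hvM, by rw [← h.eq_mod v hvM, hvj]⟩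
          · rintro ⟨hv, hvj⟩
            exact ⟨hv.lt, .inl hv, by rw [h.eq_mod v hv, hvj]⟩
        have h0 : ¬ 0 < x.demand γ τ j := fun h => hjS (hdem j hjs h)
        have h1 := hval.card_le j hjs
        have h2 := hval.low_le j hjs
        have h3 := hval.le_succ j hjs
        rw [demand] at h0
        rw [this]
        omega
    · exact h.card_regular j (by omega) (by omega)

end EqColInstance

namespace EqColInstance

open RAM Finset

variable {x : EqColInstance}

open Classical in
/-- The special colors that occur in a part with a representative below `t`. -/
noncomputable def specialUsed (x : EqColInstance) (φ : ℕ → ℕ) (t : ℕ) : Finset ℕ :=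
  {j ∈ range x.special | ∃ i < t, x.IsRep i ∧ ∃ w ∈ x.part i, φ w = j}

open Classical in
/-- The other colors that occur in a part with a representative below `t`. -/
noncomputable def regularUsed (x : EqColInstance) (φ : ℕ → ℕ) (t : ℕ) : Finset ℕ :=
  {j ∈ range x.colors | x.special ≤ j ∧ ∃ i < t, x.IsRep i ∧ ∃ w ∈ x.part i, φ w = j}

/-- A balanced coloring that uses only special colors in the modulator. -/
structure Normalized (x : EqColInstance) (φ : ℕ → ℕ) : Prop where
  lt : ∀ v < x.n, φ v < x.colors
  proper : ∀ v w, x.adj v w → φ v ≠ φ w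
  low_le : ∀ j < x.colors, x.low ≤ #{v ∈ range x.n | φ v = j}
  le_succ : ∀ j < x.colors, #{v ∈ range x.n | φ v = j} ≤ x.low + 1
  inMod : ∀ v, x.InMod v → φ v < x.special

/-- The sizes of the color classes. -/
def classSize (x : EqColInstance) (φ : ℕ → ℕ) (j : ℕ) : ℕ := #{v ∈ range x.n | φ v = j}

theorem modClass_subset (φ : ℕ → ℕ) (j : ℕ) : x.modClass φ j ⊆ {v ∈ range x.n | φ v = j} :=
  fun v hv => by
    have := mem_modClass.1 hv
    exact mem_filter.2 ⟨mem_range.2 this.1.lt, this.2⟩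

theorem Normalized.valid {φ : ℕ → ℕ} (h : x.Normalized φ) : x.Valid φ (x.classSize φ) where
  lt := h.inMod
  proper := fun v w _ _ => h.proper v w
  low_le := fun j hj => h.low_le j (hj.trans_le (min_le_right _ _))
  le_succ := fun j hj => h.le_succ j (hj.trans_le (min_le_right _ _))
  card_le := fun j _ => card_le_card (modClass_subset φ j)

/-- Vertices of the same color outside the modulator belong to the same part. -/
theorem Normalized.rep_eq {φ : ℕ → ℕ} (h : x.Normalized φ) {i i' v w : ℕ} (hi : x.IsRep i)
    (hi' : x.IsRep i') (hin : i < x.n) (hin' : i' < x.n) (hv : v ∈ x.part i)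
    (hw : w ∈ x.part i') (hvw : φ v = φ w) : i = i' :=
  rep_unique hi hi' hin hin' hv hw fun hadj => h.proper v w hadj hvw

theorem Normalized.mem_part {φ : ℕ → ℕ} (h : x.Normalized φ) {i v w : ℕ} (hi : x.IsRep i)
    (hin : i < x.n) (hv : v ∈ x.part i) (hw : w < x.n) (hwM : ¬ x.InMod w) (hvw : φ v = φ w) :
    w ∈ x.part i := by
  obtain ⟨i', hin', hi', hw'⟩ := exists_rep hw hwM
  rwa [h.rep_eq hi hi' hin hin' hv hw' hvw]

theorem Normalized.demand_eq {φ : ℕ → ℕ} (h : x.Normalized φ) {i v : ℕ} (hi : x.IsRep i)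
    (hin : i < x.n) (hv : v ∈ x.part i) :
    x.demand φ (x.classSize φ) (φ v) = #{w ∈ x.part i | φ w = φ v} := by
  classical
  rw [demand, classSize, ← card_sdiff_of_subset (modClass_subset φ _)]
  congr 1
  ext w
  rw [mem_sdiff, mem_filter, mem_filter, mem_range, mem_modClass]
  constructor
  · rintro ⟨⟨hw, hwv⟩, hwM⟩
    exact ⟨h.mem_part hi hin hv hw (fun hM => hwM ⟨hM, hwv⟩) hwv.symm, hwv⟩
  · rintro ⟨hw, hwv⟩
    have hw' := EqColInstance.mem_part.1 hw
    exact ⟨⟨hw'.1, hwv⟩, fun hM => hw'.2.1 hM.1⟩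

theorem Normalized.reach {φ : ℕ → ℕ} (h : x.Normalized φ) {t : ℕ} (ht : t ≤ x.n) :
    x.Reach φ (x.classSize φ) t (x.specialUsed φ t) #(x.regularUsed φ t) := by
  classical
  induction t with
  | zero => exact ⟨by simp [specialUsed], by simp [regularUsed]⟩
  | succ t ih =>
    have htn : t < x.n := by omega
    have ih := ih htn.le
    by_cases hrep : x.IsRep t
    swap
    · have hsame : ∀ j, (∃ i < t + 1, x.IsRep i ∧ ∃ w ∈ x.part i, φ w = j) ↔
          ∃ i < t, x.IsRep i ∧ ∃ w ∈ x.part i, φ w = j := by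
        intro j
        constructor
        · rintro ⟨i, hi, hir, hw⟩
          refine ⟨i, ?_, hir, hw⟩
          rcases (Nat.lt_succ_iff.1 hi).lt_or_eq with h | rfl
          · exact h
          · exact absurd hir hrep
        · rintro ⟨i, hi, h⟩
          exact ⟨i, by omega, h⟩
      refine .inl ⟨hrep, ?_⟩
      simpa only [specialUsed, regularUsed, hsame] using ih
    · have hsplit : ∀ j, (∃ i < t + 1, x.IsRep i ∧ ∃ w ∈ x.part i, φ w = j) ↔
          (∃ i < t, x.IsRep i ∧ ∃ w ∈ x.part i, φ w = j) ∨ ∃ w ∈ x.part t, φ w = j := by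
        intro j
        constructor
        · rintro ⟨i, hi, hir, hw⟩
          rcases (Nat.lt_succ_iff.1 hi).lt_or_eq with h | rfl
          · exact .inl ⟨i, h, hir, hw⟩
          · exact .inr hw
        · rintro (⟨i, hi, h⟩ | hw)
          · exact ⟨i, by omega, h⟩
          · exact ⟨t, by omega, hrep, hw⟩
      have hnew : ∀ w ∈ x.part t, ¬ ∃ i < t, x.IsRep i ∧ ∃ w' ∈ x.part i, φ w' = φ w := by
        rintro w hw ⟨i, hi, hir, w', hw', heq⟩
        exact hi.ne (h.rep_eq hir hrep (by omega) htn hw' hw heq)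
      let N : Finset ℕ := x.specialUsed φ (t + 1) \ x.specialUsed φ t
      let R : Finset ℕ := x.regularUsed φ (t + 1) \ x.regularUsed φ t
      have hN : ∀ j, j ∈ N ↔ j < x.special ∧ ∃ w ∈ x.part t, φ w = j := by
        intro j
        simp only [N, specialUsed, mem_sdiff, mem_filter, mem_range, hsplit]
        constructor
        · rintro ⟨⟨h1, h2⟩, h3⟩
          exact ⟨h1, h2.resolve_left fun h => h3 ⟨h1, h⟩⟩
        · rintro ⟨h1, w, hw, rfl⟩
          exact ⟨⟨h1, .inr ⟨w, hw, rfl⟩⟩, fun h => hnew w hw h.2⟩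
      have hR : ∀ j, j ∈ R ↔ x.special ≤ j ∧ ∃ w ∈ x.part t, φ w = j := by
        intro j
        simp only [R, regularUsed, mem_sdiff, mem_filter, mem_range, hsplit]
        constructor
        · rintro ⟨⟨h0, h1, h2⟩, h3⟩
          exact ⟨h1, h2.resolve_left fun h => h3 ⟨h0, h1, h⟩⟩
        · rintro ⟨h1, w, hw, rfl⟩
          exact ⟨⟨h.lt w (EqColInstance.mem_part.1 hw).1, h1, .inr ⟨w, hw, rfl⟩⟩,
            fun h => hnew w hw h.2.2⟩
      have hsubR : x.regularUsed φ t ⊆ x.regularUsed φ (t + 1) := by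
        intro j
        simp only [regularUsed, mem_filter, hsplit]
        exact fun h => ⟨h.1, h.2.1, .inl h.2.2⟩
      have hsubN : x.specialUsed φ t ⊆ x.specialUsed φ (t + 1) := by
        intro j
        simp only [specialUsed, mem_filter, hsplit]
        exact fun h => ⟨h.1, .inl h.2⟩
      have hRcard : #(x.regularUsed φ (t + 1)) - #(x.regularUsed φ t) = #R :=
        (card_sdiff_of_subset hsubR).symm
      have hsum : ∀ T ⊆ N, ∑ j ∈ T, x.demand φ (x.classSize φ) j = #{w ∈ x.part t | φ w ∈ T} := by
        intro T hT
        rw [card_eq_sum_card_fiberwise (f := φ) (s := {w ∈ x.part t | φ w ∈ T}) (t := T)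
          (fun w hw => (mem_filter.1 hw).2)]
        refine sum_congr rfl fun j hj => ?_
        obtain ⟨-, w, hw, rfl⟩ := (hN j).1 (hT hj)
        rw [h.demand_eq hrep htn hw, filter_filter]
        congr 1
        exact filter_congr fun v _ => ⟨fun h => ⟨h ▸ hj, h⟩, fun h => h.2⟩
      have hregular : #{w ∈ x.part t | φ w ∈ R} = ∑ j ∈ R, x.classSize φ j := by
        rw [card_eq_sum_card_fiberwise (f := φ) (s := {w ∈ x.part t | φ w ∈ R}) (t := R)
          (fun w hw => (mem_filter.1 hw).2)]
        refine sum_congr rfl fun j hj => ?_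
        obtain ⟨hjs, w, hw, rfl⟩ := (hR j).1 hj
        rw [classSize, filter_filter]
        congr 1
        ext v
        rw [mem_filter, mem_filter, mem_range]
        constructor
        · rintro ⟨hv, -, heq⟩
          exact ⟨(EqColInstance.mem_part.1 hv).1, heq⟩
        · rintro ⟨hv, heq⟩
          refine ⟨h.mem_part hrep htn hw hv (fun hM => ?_) heq.symm, heq ▸ hj, heq⟩
          have := h.inMod v hM
          omega
      have htotal : #(x.part t) = #{w ∈ x.part t | φ w ∈ N} + #{w ∈ x.part t | φ w ∈ R} := by
        rw [← card_filter_add_card_filter_not (s := x.part t) (fun w => φ w ∈ N)]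
        congr 2
        refine filter_congr fun w hw => ?_
        rw [hN, hR]
        have : ∃ w' ∈ x.part t, φ w' = φ w := ⟨w, hw, rfl⟩
        simp only [this, and_true, not_lt]
      have hRlt : ∀ j ∈ R, j < x.colors := fun j hj => by
        obtain ⟨-, w, hw, rfl⟩ := (hR j).1 hj
        exact h.lt w (EqColInstance.mem_part.1 hw).1
      have hlow : #R * x.low ≤ ∑ j ∈ R, x.classSize φ j := by
        rw [← smul_eq_mul]
        exact card_nsmul_le_sum _ _ _ fun j hj => h.low_le j (hRlt j hj)
      have hup : ∑ j ∈ R, x.classSize φ j ≤ #R * (x.low + 1) := by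
        rw [← smul_eq_mul]
        exact sum_le_card_nsmul _ _ _ fun j hj => h.le_succ j (hRlt j hj)
      refine .inr ⟨hrep, _, hsubN, _, card_le_card hsubR, ih, fun T hT => ?_, ?_, ?_⟩
      · rw [hsum T hT]
        refine card_le_card fun w hw => ?_
        obtain ⟨hw, hwT⟩ := mem_filter.1 hw
        refine mem_biUnion.2 ⟨φ w, hwT, mem_filter.2 ⟨hw, fun v hv hadj => ?_⟩⟩
        exact h.proper w v hadj (mem_modClass.1 hv).2.symm
      · rw [hRcard, hsum N subset_rfl, htotal, hregular]
        omega
      · rw [hRcard, hsum N subset_rfl, htotal, hregular]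
        omega

theorem low_pos (hK : 0 < x.colors) : 0 < x.low := Nat.div_pos (min_le_right _ _) hK

theorem Normalized.card_regularUsed {φ : ℕ → ℕ} (h : x.Normalized φ) :
    #(x.regularUsed φ x.n) = x.colors - x.special := by
  classical
  have : x.regularUsed φ x.n = Ico x.special x.colors := by
    ext j
    simp only [regularUsed, mem_filter, mem_range, mem_Ico]
    refine ⟨fun h => ⟨h.2.1, h.1⟩, fun hj => ⟨hj.2, hj.1, ?_⟩⟩
    have hpos : 0 < #{v ∈ range x.n | φ v = j} :=
      (low_pos (x := x) (by omega)).trans_le (h.low_le j hj.2)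
    obtain ⟨v, hv⟩ := card_pos.1 hpos
    obtain ⟨hvn, rfl⟩ := mem_filter.1 hv
    have hvM : ¬ x.InMod v := fun hM => by have := h.inMod v hM; omega
    obtain ⟨i, hin, hi, hv⟩ := exists_rep (mem_range.1 hvn) hvM
    exact ⟨i, hin, hi, v, hv, rfl⟩
  rw [this, Nat.card_Ico]

theorem mem_specialUsed {φ : ℕ → ℕ} {j : ℕ} (hj : j < x.special)
    (hd : 0 < x.demand φ (x.classSize φ) j) : j ∈ x.specialUsed φ x.n := by
  classical
  rw [demand, classSize, ← card_sdiff_of_subset (modClass_subset φ _)] at hd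
  obtain ⟨v, hv⟩ := card_pos.1 hd
  obtain ⟨hv, hvM⟩ := mem_sdiff.1 hv
  obtain ⟨hvn, rfl⟩ := mem_filter.1 hv
  obtain ⟨i, hin, hi, hv⟩ := exists_rep (mem_range.1 hvn) fun hM => hvM (mem_modClass.2 ⟨hM, rfl⟩)
  exact mem_filter.2 ⟨mem_range.2 hj, i, hin, hi, v, hv, rfl⟩

/-- There is a permutation of `{0, …, K - 1}` that maps a small set of numbers below `p`. -/
theorem exists_perm_lt {K p : ℕ} (hp : p ≤ K) (A : Finset ℕ) (hA : ∀ j ∈ A, j < K) (hAp : #A ≤ p) :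
    ∃ π : Equiv.Perm ℕ, (∀ j, π j < K ↔ j < K) ∧ ∀ j ∈ A, π j < p := by
  classical
  obtain ⟨A', hAA', hA'K, hA'⟩ := exists_subsuperset_card_eq (s := A) (t := range K) (n := p)
    (fun j hj => mem_range.2 (hA j hj)) hAp (by simpa)
  let e : {j // j ∈ A'} ≃ {j // j ∈ range p} := Finset.equivOfCardEq (by simp [hA'])
  let e' : {j : Fin K // (j : ℕ) ∈ A'} ≃ {j : Fin K // (j : ℕ) ∈ range p} :=
    { toFun := fun j => ⟨⟨e ⟨j.1, j.2⟩, (mem_range.1 (e ⟨j.1, j.2⟩).2).trans_le hp⟩,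
        (e ⟨j.1, j.2⟩).2⟩
      invFun := fun j => ⟨⟨e.symm ⟨j.1, j.2⟩, mem_range.1 (hA'K (e.symm ⟨j.1, j.2⟩).2)⟩,
        (e.symm ⟨j.1, j.2⟩).2⟩
      left_inv := fun j => by simp
      right_inv := fun j => by simp }
  let σ : Equiv.Perm (Fin K) := e'.extendSubtype
  refine ⟨σ.extendDomain (Fin.equivSubtype), fun j => ?_, fun j hj => ?_⟩
  · by_cases hj : j < K
    · rw [Equiv.Perm.extendDomain_apply_subtype (p := fun j => j < K) _ _ hj]
      simp [hj, Fin.equivSubtype]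
    · rw [Equiv.Perm.extendDomain_apply_not_subtype (p := fun j => j < K) _ _ hj]
  · rw [Equiv.Perm.extendDomain_apply_subtype (p := fun j => j < K) _ _ (hA j hj)]
    have := e'.extendSubtype_mem ⟨j, hA j hj⟩ (hAA' hj)
    simpa [Fin.equivSubtype] using this

theorem BalancedColorable.exists_normalized (h : x.BalancedColorable) : ∃ φ, x.Normalized φ := by
  classical
  obtain ⟨φ, hlt, hprop, hcard⟩ := h
  obtain ⟨π, hπ, hπA⟩ := exists_perm_lt (K := x.colors) (p := x.special) (min_le_right _ _)
    (({v ∈ range x.n | x.InMod v} : Finset ℕ).image φ)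
    (fun j hj => by
      obtain ⟨v, hv, rfl⟩ := mem_image.1 hj
      exact hlt v (mem_range.1 (mem_filter.1 hv).1))
    (le_min (card_image_le.trans (by rw [modSize, count_eq_card])) (by
      rw [← card_range x.colors]
      refine card_le_card fun j hj => ?_
      obtain ⟨v, hv, rfl⟩ := mem_image.1 hj
      exact mem_range.2 (hlt v (mem_range.1 (mem_filter.1 hv).1))))
  have hfib : ∀ j, {v ∈ range x.n | π (φ v) = j} = {v ∈ range x.n | φ v = π.symm j} :=
    fun j => filter_congr fun v _ => by rw [Equiv.eq_symm_apply]
  have hsymm : ∀ j < x.colors, π.symm j < x.colors := fun j hj => by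
    rw [← hπ]; simpa using hj
  exact ⟨fun v => π (φ v), fun v hv => (hπ _).2 (hlt v hv),
    fun v w hvw h => hprop v w hvw (π.injective h),
    fun j hj => by rw [hfib]; exact (hcard _ (hsymm j hj)).1,
    fun j hj => by rw [hfib]; exact (hcard _ (hsymm j hj)).2,
    fun v hv => hπA _ (mem_image_of_mem _ (mem_filter.2 ⟨mem_range.2 hv.lt, hv⟩))⟩

theorem balancedColorable_iff : x.BalancedColorable ↔ ∃ γ τ, x.Valid γ τ ∧
    ∃ S, (∀ j ∈ S, j < x.special) ∧ (∀ j < x.special, 0 < x.demand γ τ j → j ∈ S) ∧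
      x.Reach γ τ x.n S (x.colors - x.special) := by
  classical
  constructor
  · intro h
    obtain ⟨φ, h⟩ := h.exists_normalized
    refine ⟨φ, x.classSize φ, h.valid, x.specialUsed φ x.n,
      fun j hj => mem_range.1 (mem_filter.1 hj).1, fun j hj => mem_specialUsed hj, ?_⟩
    rw [← h.card_regularUsed]
    exact h.reach le_rfl
  · rintro ⟨γ, τ, hval, S, hS, hdem, h⟩
    exact balancedColorable_of_reach hval hS hdem h

/-! ## Equitable colorings are balanced colorings with at most `n` colors -/

theorem equitablyColorable_iff : x.G.EquitablyColorable x.k ↔ x.BalancedColorable := by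
  classical
  have hncard : ∀ {k : ℕ} (φ : x.G.Coloring (Fin k)) (f : ℕ → ℕ), (∀ v, f v.1 = (φ v).1) →
      ∀ i : Fin k, (φ.colorClass i).ncard = #{v ∈ range x.n | f v = i.1} := by
    intro k φ f hf i
    rw [Set.ncard_eq_toFinset_card', ← card_map Fin.valEmbedding]
    congr 1
    ext v
    simp only [mem_map, Set.mem_toFinset, mem_filter, mem_range]
    constructor
    · rintro ⟨w, rfl, rfl⟩
      exact ⟨w.2, hf w⟩
    · rintro ⟨hv, h⟩
      exact ⟨⟨v, hv⟩, Fin.ext (by rw [← hf]; exact h), rfl⟩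
  rcases le_or_gt x.n x.k with hk | hk
  · have hcol : x.colors = x.n := min_eq_right hk
    have h1 : x.G.EquitablyColorable x.k := by
      refine ⟨SimpleGraph.Coloring.mk (fun v => ⟨v.1, v.2.trans_le hk⟩) ?_, fun i => ?_⟩
      · intro v w hvw h
        exact hvw.ne (Fin.ext (by simpa using h))
      · rw [hncard _ id (fun v => rfl), Fintype.card_fin]
        have hc : #{v ∈ range x.n | id v = i.1} = if i.1 < x.n then 1 else 0 := by
          simp [filter_eq', apply_ite]
        rw [hc]
        have hkpos : 0 < x.k := i.pos
        rcases hk.lt_or_eq with hlt | heq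
        · rw [Nat.div_eq_of_lt hlt]
          refine ⟨Nat.zero_le _, ?_⟩
          split_ifs with hi
          · rw [Nat.ceilDiv_eq_add_pred_div, Nat.one_le_div_iff hkpos]
            omega
          · exact Nat.zero_le _
        · have hi : i.1 < x.n := i.2.trans_eq heq.symm
          rw [if_pos hi, heq, Nat.div_self hkpos, Nat.ceilDiv_eq_add_pred_div,
            Nat.one_le_div_iff hkpos]
          omega
    refine iff_of_true h1 ⟨id, fun v hv => by rwa [hcol], ?_, fun j hj => ?_⟩
    · rintro v w hvw rfl
      exact x.adj_irrefl _ hvw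
    · rw [hcol] at hj
      have hc : #{v ∈ range x.n | id v = j} = 1 := by
        simp [filter_eq', hj]
      rw [hc, low, hcol, Nat.div_self (by omega)]
      omega
  · have hcol : x.colors = x.k := min_eq_left hk.le
    have hceil : 0 < x.k → x.n ⌈/⌉ x.k ≤ x.low + 1 := fun h => by
      rw [Nat.ceilDiv_eq_add_pred_div, low, hcol, ← Nat.add_div_right _ h]
      exact Nat.div_le_div_right (by omega)
    constructor
    · rintro ⟨φ, hφ⟩
      let f : ℕ → ℕ := fun v => if hv : v < x.n then (φ ⟨v, hv⟩).1 else 0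
      have hf : ∀ v : Fin x.n, f v.1 = (φ v).1 := fun v => by simp [f]
      refine ⟨f, fun v hv => ?_, ?_, fun j hj => ?_⟩
      · rw [hcol, hf ⟨v, hv⟩]; exact (φ _).2
      · rintro v w ⟨hv, hw, hvw⟩ h
        rw [hf ⟨v, hv⟩, hf ⟨w, hw⟩] at h
        exact φ.valid hvw (Fin.ext h)
      · rw [hcol] at hj
        have := hφ ⟨j, hj⟩
        rw [hncard φ f hf, Fintype.card_fin] at this
        rw [low, hcol]
        refine ⟨this.1, this.2.trans ?_⟩
        have := hceil (by omega)
        rwa [low, hcol] at this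
    · rintro ⟨f, hlt, hprop, hcard⟩
      rw [hcol] at hlt hcard
      let φ : x.G.Coloring (Fin x.k) := SimpleGraph.Coloring.mk (fun v => ⟨f v.1, hlt v.1 v.2⟩) (by
        intro v w hvw h
        exact hprop v.1 w.1 ⟨v.2, w.2, hvw⟩ (by simpa using h))
      refine ⟨φ, fun i => ?_⟩
      rw [hncard φ f (fun v => rfl), Fintype.card_fin]
      have hi := hcard i.1 i.2
      have hlow : x.low = x.n / x.k := by rw [low, hcol]
      rw [← hlow]
      refine ⟨hi.1, ?_⟩
      have hkpos : 0 < x.k := i.pos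
      by_contra hcon
      have hsum : x.n = ∑ j ∈ range x.k, #{v ∈ range x.n | f v = j} := by
        conv_lhs => rw [← card_range x.n]
        exact card_eq_sum_card_fiberwise fun v hv => mem_range.2 (hlt v (mem_range.1 hv))
      have hgt : x.k * x.low < x.n := by
        conv_rhs => rw [hsum]
        have h0 : x.low ≤ x.n ⌈/⌉ x.k := by
          rw [hlow, Nat.ceilDiv_eq_add_pred_div]
          exact Nat.div_le_div_right (by omega)
        calc x.k * x.low = ∑ _j ∈ range x.k, x.low := by simp
          _ < _ := sum_lt_sum (fun j hj => (hcard j (mem_range.1 hj)).1)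
            ⟨i.1, mem_range.2 i.2, by omega⟩
      have : x.low + 1 ≤ x.n ⌈/⌉ x.k := by
        rw [Nat.ceilDiv_eq_add_pred_div, Nat.le_div_iff_mul_le hkpos, Nat.add_mul, mul_comm x.low]
        omega
      omega

end EqColInstance

/-! ## The dynamic program on numbers -/

namespace EqColInstance

open RAM Finset

variable (x : EqColInstance)

/-- The vertex `v` of the modulator gets the color `j` in the coloring with the code `g`. -/
def HasColor (g v j : ℕ) : Prop :=
  Mem (x.modSize * x.modSize) g (x.rank v * x.modSize + j)

/-- The number `g` codes a proper coloring of the modulator by special colors. -/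
def IsColorCode (g : ℕ) : Prop :=
  (∀ v < x.n, x.InMod v → ∃ j < x.special, x.HasColor g v j) ∧
    (∀ v < x.n, x.InMod v → ∀ j < x.special, ∀ j' < x.special,
      x.HasColor g v j → x.HasColor g v j' → j = j') ∧
    ∀ v < x.n, ∀ w < x.n, x.InMod v → x.InMod w → x.adj v w →
      ∀ j < x.special, ¬ (x.HasColor g v j ∧ x.HasColor g w j)

/-- The number of vertices of the modulator with color `j`. -/
noncomputable def modCount (g j : ℕ) : ℕ := count x.n fun v => x.InMod v ∧ x.HasColor g v j

/-- The target size of the color `j`, where `L` codes the set of large special classes. -/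
noncomputable def target (L j : ℕ) : ℕ := x.low + ind (Mem x.special L j)

/-- The number of vertices missing in the class of the special color `j`. -/
noncomputable def missing (g L j : ℕ) : ℕ := x.target L j - x.modCount g j

/-- The size of the part of `i`. -/
noncomputable def partSize (i : ℕ) : ℕ := count x.n fun w => ¬ x.InMod w ∧ ¬ x.adj i w

/-- The number of vertices in the part of `i` to which a color from the set `T` is available. -/
noncomputable def availSize (g i T : ℕ) : ℕ :=
  count x.n fun w => (¬ x.InMod w ∧ ¬ x.adj i w) ∧ ∃ j < x.special, Mem x.special T j ∧
    ∀ v < x.n, x.InMod v → x.HasColor g v j → ¬ x.adj w v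

/-- The number of vertices missing in the classes of the colors in `m` but not in `m₀`. -/
noncomputable def missingDiff (g L m₀ m : ℕ) : ℕ :=
  sumOver x.special (fun j => Mem x.special m j ∧ ¬ Mem x.special m₀ j) (x.missing g L)

/-- The part of `i` can be colored by the special colors in `m` but not in `m₀`, and `c` others. -/
def FeasibleCode (g L i m₀ m c : ℕ) : Prop :=
  (∀ T < 2 ^ x.special, (∀ j < x.special, Mem x.special T j →
      Mem x.special m j ∧ ¬ Mem x.special m₀ j) →
    sumOver x.special (Mem x.special T) (x.missing g L) ≤ x.availSize g i T) ∧
  c * x.low + x.missingDiff g L m₀ m ≤ x.partSize i ∧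
  x.partSize i ≤ c * (x.low + 1) + x.missingDiff g L m₀ m

/-- The number of entries of a table. -/
noncomputable def tableSize : ℕ := 2 ^ x.special * (x.colors + 1)

/-- The entry of the table `T` at the set with the code `m` and the number `c`. -/
def Entry (T m c : ℕ) : Prop := Mem x.tableSize T (m * (x.colors + 1) + c)

/-- The entries of the next table. -/
def NextEntry (g L i T m c : ℕ) : Prop :=
  (¬ x.IsRep i ∧ x.Entry T m c) ∨
    (x.IsRep i ∧ ∃ m₀ < 2 ^ x.special, (∀ j < x.special, Mem x.special m₀ j → Mem x.special m j) ∧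
      ∃ c₀ < x.colors + 1, c₀ ≤ c ∧ x.Entry T m₀ c₀ ∧ x.FeasibleCode g L i m₀ m (c - c₀))

/-- The next table. -/
noncomputable def nextTable (g L i T : ℕ) : ℕ :=
  tab x.tableSize fun q => ∃ m < 2 ^ x.special, ∃ c < x.colors + 1,
    q = m * (x.colors + 1) + c ∧ x.NextEntry g L i T m c

/-- The table after `t` rounds. -/
noncomputable def table (g L t : ℕ) : ℕ :=
  rounds (tab x.tableSize fun q => q = 0) (x.nextTable g L) t

/-- The algorithm accepts. -/
def Accepts : Prop :=
  ∃ g < 2 ^ (x.modSize * x.modSize), x.IsColorCode g ∧ ∃ L < 2 ^ x.special,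
    (∀ j < x.special, x.modCount g j ≤ x.target L j) ∧ ∃ m < 2 ^ x.special,
      (∀ j < x.special, 0 < x.missing g L j → Mem x.special m j) ∧
      x.Entry (x.table g L x.n) m (x.colors - x.special)

open Classical in
/-- The set of special colors with the code `m`. -/
noncomputable def decode (m : ℕ) : Finset ℕ := {j ∈ range x.special | Mem x.special m j}

variable {x}

theorem mem_decode {m j : ℕ} : j ∈ x.decode m ↔ Mem x.special m j := by
  simpa [decode] using fun h : Mem x.special m j => h.2.1

theorem decode_tab {S : Finset ℕ} (hS : ∀ j ∈ S, j < x.special) :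
    x.decode (tab x.special (· ∈ S)) = S := by
  ext j
  rw [mem_decode, mem_tab]
  exact ⟨fun h => h.2, fun h => ⟨hS j h, h⟩⟩

theorem sumOver_eq_sum (B : ℕ) (p : ℕ → Prop) [DecidablePred p] (f : ℕ → ℕ) :
    sumOver B p f = ∑ i ∈ range B with p i, f i := by
  rw [sum_filter]
  exact sum_congr rfl fun i _ => by by_cases h : p i <;> simp [h]

theorem pair_inj {M i j i' j' : ℕ} (hj : j < M) (hj' : j' < M) (h : i * M + j = i' * M + j') :
    i = i' ∧ j = j' := by
  have h1 := congrArg (· / M) h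
  have h2 := congrArg (· % M) h
  simp only [mul_comm _ M, Nat.mul_add_div (by omega : 0 < M), Nat.mul_add_mod,
    Nat.div_eq_of_lt hj, Nat.div_eq_of_lt hj', Nat.mod_eq_of_lt hj, Nat.mod_eq_of_lt hj'] at h1 h2
  exact ⟨by omega, h2⟩

theorem rank_lt_rank {v w : ℕ} (hv : x.InMod v) (hvw : v < w) : x.rank v < x.rank w := by
  classical
  rw [rank, rank, count_eq_card, count_eq_card]
  refine card_lt_card ⟨fun a ha => ?_, fun h => ?_⟩
  · simp only [mem_filter] at ha ⊢
    exact ⟨ha.1, ha.2.1.trans hvw, ha.2.2⟩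
  · have := h (mem_filter.2 ⟨mem_range.2 hv.lt, hvw, hv⟩)
    exact lt_irrefl _ (mem_filter.1 this).2.1

theorem rank_lt_modSize {v : ℕ} (hv : x.InMod v) : x.rank v < x.modSize := by
  classical
  rw [rank, modSize, count_eq_card, count_eq_card]
  refine card_lt_card ⟨fun a ha => ?_, fun h => ?_⟩
  · simp only [mem_filter] at ha ⊢
    exact ⟨ha.1, ha.2.2⟩
  · have := h (mem_filter.2 ⟨mem_range.2 hv.lt, hv⟩)
    exact lt_irrefl _ (mem_filter.1 this).2.1

theorem rank_inj {v w : ℕ} (hv : x.InMod v) (hw : x.InMod w) (h : x.rank v = x.rank w) : v = w := by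
  rcases lt_trichotomy v w with h' | h' | h'
  · exact absurd h (rank_lt_rank hv h').ne
  · exact h'
  · exact absurd h (rank_lt_rank hw h').ne'

/-- The number `g` is a code of the coloring `γ` of the modulator. -/
def Codes (x : EqColInstance) (g : ℕ) (γ : ℕ → ℕ) : Prop :=
  ∀ v, x.InMod v → γ v < x.special ∧ ∀ j < x.special, x.HasColor g v j ↔ γ v = j

theorem IsColorCode.exists_codes {g : ℕ} (h : x.IsColorCode g) :
    ∃ γ, x.Codes g γ ∧ ∀ v w, x.InMod v → x.InMod w → x.adj v w → γ v ≠ γ w := by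
  obtain ⟨h1, h2, h3⟩ := h
  have : ∀ v, x.InMod v → ∃ j < x.special, x.HasColor g v j := fun v hv => h1 v hv.lt hv
  choose! γ hγ hγ' using this
  refine ⟨γ, fun v hv => ⟨hγ v hv, fun j hj => ⟨fun h => ?_, fun h => h ▸ hγ' v hv⟩⟩, ?_⟩
  · exact h2 v hv.lt hv _ (hγ v hv) _ hj (hγ' v hv) h
  · intro v w hv hw hvw heq
    exact h3 v hv.lt w hw.lt hv hw hvw (γ v) (hγ v hv) ⟨hγ' v hv, heq ▸ hγ' w hw⟩

theorem exists_code {γ : ℕ → ℕ} (hγ : ∀ v, x.InMod v → γ v < x.special) :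
    ∃ g < 2 ^ (x.modSize * x.modSize), x.Codes g γ := by
  have hsp : x.special ≤ x.modSize := min_le_left _ _
  refine ⟨tab (x.modSize * x.modSize) fun q => ∃ v, x.InMod v ∧ q = x.rank v * x.modSize + γ v,
    tab_lt _ _, fun v hv => ⟨hγ v hv, fun j hj => ?_⟩⟩
  rw [HasColor, mem_tab]
  constructor
  · rintro ⟨-, w, hw, h⟩
    obtain ⟨h1, h2⟩ := pair_inj (hj.trans_le hsp) ((hγ w hw).trans_le hsp) h
    rw [rank_inj hv hw h1, h2]
  · rintro rfl
    have := rank_lt_modSize hv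
    exact ⟨by nlinarith, v, hv, rfl⟩

theorem Codes.isColorCode {g : ℕ} {γ : ℕ → ℕ} (h : x.Codes g γ)
    (hp : ∀ v w, x.InMod v → x.InMod w → x.adj v w → γ v ≠ γ w) : x.IsColorCode g := by
  refine ⟨fun v _ hv => ⟨γ v, (h v hv).1, ((h v hv).2 _ (h v hv).1).2 rfl⟩,
    fun v _ hv j hj j' hj' h1 h2 => ?_, fun v _ w _ hv hw hvw j hj h12 => ?_⟩
  · rw [← ((h v hv).2 j hj).1 h1, ← ((h v hv).2 j' hj').1 h2]
  · exact hp v w hv hw hvw ((((h v hv).2 j hj).1 h12.1).trans (((h w hw).2 j hj).1 h12.2).symm)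

theorem Codes.modCount_eq {g : ℕ} {γ : ℕ → ℕ} (h : x.Codes g γ) {j : ℕ} (hj : j < x.special) :
    x.modCount g j = #(x.modClass γ j) := by
  classical
  rw [modCount, count_eq_card, modClass]
  exact congrArg card (filter_congr fun v _ => and_congr_right fun hv => (h v hv).2 j hj)

theorem partSize_eq (i : ℕ) : x.partSize i = #(x.part i) := by
  classical
  rw [partSize, count_eq_card, part]

theorem missing_eq {g L : ℕ} {γ τ : ℕ → ℕ} (hg : x.Codes g γ)
    (hτ : ∀ j < x.special, τ j = x.target L j)
    {j : ℕ} (hj : j < x.special) : x.missing g L j = x.demand γ τ j := by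
  rw [missing, demand, hτ j hj, hg.modCount_eq hj]

theorem sumOver_missing_eq {g L : ℕ} {γ τ : ℕ → ℕ} (hg : x.Codes g γ)
    (hτ : ∀ j < x.special, τ j = x.target L j)
    {T : ℕ} :
    sumOver x.special (Mem x.special T) (x.missing g L) = ∑ j ∈ x.decode T, x.demand γ τ j := by
  classical
  rw [sumOver_eq_sum]
  refine sum_congr rfl fun j hj => missing_eq hg hτ (mem_range.1 (mem_filter.1 hj).1)

theorem missingDiff_eq {g L : ℕ} {γ τ : ℕ → ℕ} (hg : x.Codes g γ)
    (hτ : ∀ j < x.special, τ j = x.target L j)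
    {m₀ m : ℕ} :
    x.missingDiff g L m₀ m = ∑ j ∈ x.decode m \ x.decode m₀, x.demand γ τ j := by
  classical
  rw [missingDiff, sumOver_eq_sum]
  refine sum_congr ?_ fun j hj => missing_eq hg hτ ?_
  · ext j
    rw [mem_filter, mem_range, mem_sdiff, mem_decode, mem_decode]
    exact ⟨fun h => h.2, fun h => ⟨h.1.2.1, h⟩⟩
  · exact (mem_decode.1 (mem_sdiff.1 hj).1).2.1

theorem availSize_eq {g : ℕ} {γ : ℕ → ℕ} (hg : x.Codes g γ) {i T : ℕ} :
    x.availSize g i T = #((x.decode T).biUnion (x.avail γ i)) := by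
  classical
  rw [availSize, count_eq_card]
  congr 1
  ext w
  simp only [mem_filter, mem_range, mem_biUnion, mem_decode, avail, mem_part, mem_modClass]
  constructor
  · rintro ⟨hw, h1, j, hj, hjT, h2⟩
    refine ⟨j, hjT, ⟨hw, h1⟩, fun v hv => ?_⟩
    exact h2 v hv.1.lt hv.1 (((hg v hv.1).2 j hj).2 hv.2)
  · rintro ⟨j, hjT, ⟨hw, h1⟩, h2⟩
    refine ⟨hw, h1, j, hjT.2.1, hjT, fun v _ hv hc => ?_⟩
    exact h2 v ⟨hv, ((hg v hv).2 j hjT.2.1).1 hc⟩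

theorem feasibleCode_iff {g L : ℕ} {γ τ : ℕ → ℕ} (hg : x.Codes g γ)
    (hτ : ∀ j < x.special, τ j = x.target L j)
    {i m₀ m c : ℕ} : x.FeasibleCode g L i m₀ m c ↔
    x.Feasible γ τ i (x.decode m \ x.decode m₀) c := by
  rw [FeasibleCode, Feasible, missingDiff_eq hg hτ, partSize_eq]
  refine and_congr_left fun _ => ⟨fun h T hT => ?_, fun h T hT hTm => ?_⟩
  · have hTs : ∀ j ∈ T, j < x.special := fun j hj =>
      (mem_decode.1 (mem_sdiff.1 (hT hj)).1).2.1
    have := h (tab x.special (· ∈ T)) (tab_lt _ _) fun j hj hjT => by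
      have := mem_sdiff.1 (hT (mem_tab.1 hjT).2)
      rwa [mem_decode, mem_decode] at this
    rwa [sumOver_missing_eq hg hτ, availSize_eq hg, decode_tab hTs] at this
  · rw [sumOver_missing_eq hg hτ, availSize_eq hg]
    refine h _ fun j hj => ?_
    rw [mem_decode] at hj
    rw [mem_sdiff, mem_decode, mem_decode]
    exact hTm j hj.2.1 hj

theorem entry_table_iff {g L : ℕ} {γ τ : ℕ → ℕ} (hg : x.Codes g γ)
    (hτ : ∀ j < x.special, τ j = x.target L j)
    {t m c : ℕ} (hm : m < 2 ^ x.special) (hc : c < x.colors + 1) :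
    x.Entry (x.table g L t) m c ↔ x.Reach γ τ t (x.decode m) c := by
  have hidx : ∀ {m c : ℕ}, m < 2 ^ x.special → c < x.colors + 1 →
      m * (x.colors + 1) + c < x.tableSize := fun {m c} hm hc => by
    rw [tableSize]; nlinarith
  induction t generalizing m c with
  | zero =>
    rw [Entry, table, rounds, mem_tab, Reach]
    have h0 : x.decode m = ∅ ↔ m = 0 := by
      constructor
      · intro h
        refine Nat.eq_of_testBit_eq fun j => ?_
        rw [Nat.zero_testBit]
        by_contra hj
        rw [Bool.not_eq_false] at hj
        have hjs : j < x.special := by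
          by_contra hle
          rw [Nat.testBit_lt_two_pow (hm.trans_le
            (Nat.pow_le_pow_right (by norm_num) (not_lt.1 hle)))] at hj
          exact absurd hj (by simp)
        have : j ∈ x.decode m := mem_decode.2 ⟨hm, hjs, hj⟩
        simp [h] at this
      · rintro rfl
        ext j
        simp [mem_decode, Mem]
    rw [h0]
    constructor
    · rintro ⟨-, h⟩
      rw [Nat.add_eq_zero_iff, Nat.mul_eq_zero] at h
      omega
    · rintro ⟨rfl, rfl⟩
      exact ⟨hidx hm hc, by simp⟩
  | succ t ih =>
    rw [Entry, table, rounds, nextTable, mem_tab, Reach, ← table]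
    have hstep : (m * (x.colors + 1) + c < x.tableSize ∧ ∃ m' < 2 ^ x.special, ∃ c' < x.colors + 1,
        m * (x.colors + 1) + c = m' * (x.colors + 1) + c' ∧
          x.NextEntry g L t (x.table g L t) m' c') ↔
        x.NextEntry g L t (x.table g L t) m c := by
      constructor
      · rintro ⟨-, m', hm', c', hc', heq, h⟩
        obtain ⟨rfl, rfl⟩ := pair_inj hc hc' heq
        exact h
      · exact fun h => ⟨hidx hm hc, m, hm, c, hc, rfl, h⟩
    rw [hstep]
    refine or_congr (and_congr_right fun _ => ih hm hc) (and_congr_right fun _ => ⟨?_, ?_⟩)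
    · rintro ⟨m₀, hm₀, hsub, c₀, hc₀, hle, hE, hF⟩
      exact ⟨x.decode m₀, fun j hj => mem_decode.2 (hsub j (mem_decode.1 hj).2.1 (mem_decode.1 hj)),
        c₀, hle, (ih hm₀ hc₀).1 hE, (feasibleCode_iff hg hτ).1 hF⟩
    · rintro ⟨S₀, hS₀, c₀, hle, hE, hF⟩
      have hdec : x.decode (tab x.special (· ∈ S₀)) = S₀ :=
        decode_tab fun j hj => (mem_decode.1 (hS₀ hj)).2.1
      refine ⟨tab x.special (· ∈ S₀), tab_lt _ _, fun j hj h => ?_, c₀, by omega, hle, ?_, ?_⟩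
      · exact mem_decode.1 (hS₀ (mem_tab.1 h).2)
      · exact (ih (tab_lt _ _) (by omega)).2 (hdec.symm ▸ hE)
      · rw [feasibleCode_iff hg hτ, hdec]; exact hF

theorem accepts_iff : x.Accepts ↔ x.BalancedColorable := by
  rw [balancedColorable_iff]
  have hc : x.colors - x.special < x.colors + 1 := by omega
  constructor
  · rintro ⟨g, -, hgc, L, -, hL, m, hm, hdem, hE⟩
    obtain ⟨γ, hg, hprop⟩ := hgc.exists_codes
    have hτ : ∀ j < x.special, x.target L j = x.target L j := fun _ _ => rfl
    refine ⟨γ, x.target L, ⟨fun v hv => (hg v hv).1, hprop, fun j _ => Nat.le_add_right _ _,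
      fun j _ => Nat.add_le_add_left (ind_le_one _) _, fun j hj => ?_⟩, x.decode m,
      fun j hj => (mem_decode.1 hj).2.1, fun j hj h => ?_, (entry_table_iff hg hτ hm hc).1 hE⟩
    · rw [← hg.modCount_eq hj]; exact hL j hj
    · rw [← missing_eq hg hτ hj] at h
      exact mem_decode.2 (hdem j hj h)
  · rintro ⟨γ, τ, hval, S, hS, hdem, hR⟩
    obtain ⟨g, hglt, hg⟩ := exists_code hval.lt
    let L := tab x.special fun j => τ j = x.low + 1
    have hτ : ∀ j < x.special, τ j = x.target L j := by
      intro j hj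
      have h1 := hval.low_le j hj
      have h2 := hval.le_succ j hj
      by_cases h : τ j = x.low + 1
      · rw [target, ind_true (mem_tab.2 ⟨hj, h⟩), h]
      · rw [target, ind_false (p := Mem x.special L j) fun h' => h (mem_tab.1 h').2]
        omega
    refine ⟨g, hglt, hg.isColorCode hval.proper, L, tab_lt _ _, fun j hj => ?_,
      tab x.special (· ∈ S), tab_lt _ _, fun j hj h => ?_, ?_⟩
    · rw [hg.modCount_eq hj, ← hτ j hj]; exact hval.card_le j hj
    · rw [missing_eq hg hτ hj] at h
      exact mem_tab.2 ⟨hj, hdem j hj h⟩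
    · rw [entry_table_iff hg hτ (tab_lt _ _) hc, decode_tab hS]; exact hR

end EqColInstance

namespace EquitableColoringComp

open RAM EqColInstance Finset

local notation "EC" => equitableColoringByDistToCoCluster

variable {α : Type} {Γ : Ctx EC α}

theorem compP_hasColor {g v j : α → ℕ} (hg : Comp Γ g) (hv : Comp Γ v) (hj : Comp Γ j) :
    CompP Γ fun a => HasColor (Γ.inst a) (g a) (v a) (j a) :=
  CompP.mem (loopBound_modSize.mul loopBound_modSize) hg
    (((comp_rank hv).mul loopBound_modSize).add hj)

theorem compP_mem_special {T j : α → ℕ} (hT : Comp Γ T) (hj : Comp Γ j) :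
    CompP Γ fun a => Mem (special (Γ.inst a)) (T a) (j a) :=
  CompP.mem loopBound_special hT hj

theorem compP_isColorCode {g : α → ℕ} (hg : Comp Γ g) :
    CompP Γ fun a => IsColorCode (Γ.inst a) (g a) := by
  refine CompP.and ?_ (CompP.and ?_ ?_)
  · exact CompP.forall (p := fun _ _ => _) loopBound_n (.imp (compP_inMod (Comp.last Γ))
      (CompP.exists (Γ := Γ.ext) (p := fun _ _ => _) loopBound_special
        (compP_hasColor hg.wk.wk (Comp.last Γ).wk (Comp.last _))))
  · exact CompP.forall (p := fun _ _ => _) loopBound_n (.imp (compP_inMod (Comp.last Γ))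
      (CompP.forall (Γ := Γ.ext) (p := fun _ _ => _) loopBound_special
        (CompP.forall (Γ := Γ.ext.ext) (p := fun _ _ => _) loopBound_special
          (.imp (compP_hasColor hg.wk.wk.wk (Comp.last Γ).wk.wk (Comp.last _).wk)
            (.imp (compP_hasColor hg.wk.wk.wk (Comp.last Γ).wk.wk (Comp.last _))
              (.eq (Comp.last _).wk (Comp.last _)))))))
  · exact CompP.forall (p := fun _ _ => _) loopBound_n
      (CompP.forall (Γ := Γ.ext) (p := fun _ _ => _) loopBound_n
        (.imp (compP_inMod (Comp.last Γ).wk) (.imp (compP_inMod (Comp.last _))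
          (.imp (compP_adj (Comp.last Γ).wk (Comp.last _))
            (CompP.forall (Γ := Γ.ext.ext) (p := fun _ _ => _) loopBound_special
              (.not (.and (compP_hasColor hg.wk.wk.wk (Comp.last Γ).wk.wk (Comp.last _))
                (compP_hasColor hg.wk.wk.wk (Comp.last Γ.ext).wk (Comp.last _)))))))))

theorem comp_modCount {g j : α → ℕ} (hg : Comp Γ g) (hj : Comp Γ j) :
    Comp Γ fun a => modCount (Γ.inst a) (g a) (j a) :=
  Comp.count (p := fun _ _ => _) loopBound_n
    (.and (compP_inMod (Comp.last Γ)) (compP_hasColor hg.wk (Comp.last _) hj.wk))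

theorem comp_target {L j : α → ℕ} (hL : Comp Γ L) (hj : Comp Γ j) :
    Comp Γ fun a => target (Γ.inst a) (L a) (j a) :=
  (loopBound_low.comp Γ).add (compP_mem_special hL hj)

theorem comp_missing {g L j : α → ℕ} (hg : Comp Γ g) (hL : Comp Γ L) (hj : Comp Γ j) :
    Comp Γ fun a => missing (Γ.inst a) (g a) (L a) (j a) :=
  (comp_target hL hj).sub (comp_modCount hg hj)

theorem compP_mem_part {i w : α → ℕ} (hi : Comp Γ i) (hw : Comp Γ w) :
    CompP Γ fun a => ¬ InMod (Γ.inst a) (w a) ∧ ¬ EqColInstance.adj (Γ.inst a) (i a) (w a) :=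
  (compP_inMod hw).not.and (compP_adj hi hw).not

theorem comp_partSize {i : α → ℕ} (hi : Comp Γ i) : Comp Γ fun a => partSize (Γ.inst a) (i a) :=
  Comp.count (p := fun _ _ => _) loopBound_n (compP_mem_part (Γ := Γ.ext) hi.wk (Comp.last _))

theorem comp_availSize {g i T : α → ℕ} (hg : Comp Γ g) (hi : Comp Γ i) (hT : Comp Γ T) :
    Comp Γ fun a => availSize (Γ.inst a) (g a) (i a) (T a) :=
  Comp.count (p := fun _ _ => _) loopBound_n
    ((compP_mem_part (Γ := Γ.ext) hi.wk (Comp.last _)).and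
      (CompP.exists (Γ := Γ.ext) (p := fun _ _ => _) loopBound_special
        ((compP_mem_special (Γ := Γ.ext.ext) hT.wk.wk (Comp.last _)).and
          (CompP.forall (Γ := Γ.ext.ext) (p := fun _ _ => _) loopBound_n
            (.imp (compP_inMod (Γ := Γ.ext.ext.ext) (Comp.last _))
              (.imp (compP_hasColor (Γ := Γ.ext.ext.ext) hg.wk.wk.wk (Comp.last _) (Comp.last _).wk)
                (compP_adj (Γ := Γ.ext.ext.ext) (Comp.last Γ).wk.wk (Comp.last _)).not))))))

theorem comp_missingDiff {g L m₀ m : α → ℕ} (hg : Comp Γ g) (hL : Comp Γ L) (hm₀ : Comp Γ m₀)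
    (hm : Comp Γ m) : Comp Γ fun a => missingDiff (Γ.inst a) (g a) (L a) (m₀ a) (m a) :=
  Comp.sumOver (p := fun _ _ => _) (F := fun _ _ => _) loopBound_special
    ((compP_mem_special (Γ := Γ.ext) hm.wk (Comp.last _)).and
      (compP_mem_special (Γ := Γ.ext) hm₀.wk (Comp.last _)).not)
    (comp_missing (Γ := Γ.ext) hg.wk hL.wk (Comp.last _))

theorem compP_feasibleCode {g L i m₀ m c : α → ℕ} (hg : Comp Γ g) (hL : Comp Γ L) (hi : Comp Γ i)
    (hm₀ : Comp Γ m₀) (hm : Comp Γ m) (hc : Comp Γ c) :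
    CompP Γ fun a => FeasibleCode (Γ.inst a) (g a) (L a) (i a) (m₀ a) (m a) (c a) := by
  have hD := comp_missingDiff hg hL hm₀ hm
  refine CompP.and ?_ (CompP.and ?_ ?_)
  · exact CompP.forall (p := fun _ _ => _) loopBound_two_pow_special
      (.imp (CompP.forall (Γ := Γ.ext) (p := fun _ _ => _) loopBound_special
        (.imp (compP_mem_special (Γ := Γ.ext.ext) (Comp.last _).wk (Comp.last _))
          ((compP_mem_special (Γ := Γ.ext.ext) hm.wk.wk (Comp.last _)).and
            (compP_mem_special (Γ := Γ.ext.ext) hm₀.wk.wk (Comp.last _)).not)))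
        (.le (Comp.sumOver (Γ := Γ.ext) (p := fun _ _ => _) (F := fun _ _ => _) loopBound_special
          (compP_mem_special (Γ := Γ.ext.ext) (Comp.last _).wk (Comp.last _))
          (comp_missing (Γ := Γ.ext.ext) hg.wk.wk hL.wk.wk (Comp.last _)))
          (comp_availSize (Γ := Γ.ext) hg.wk hi.wk (Comp.last _))))
  · exact .le ((hc.mul loopBound_low).add hD) (comp_partSize hi)
  · exact .le (comp_partSize hi) ((hc.mul (loopBound_low.add (.const 1))).add hD)

theorem compP_isRep {i : α → ℕ} (hi : Comp Γ i) : CompP Γ fun a => IsRep (Γ.inst a) (i a) :=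
  (compP_inMod hi).not.and (CompP.forall (p := fun _ _ => _) loopBound_n
    (.imp (.lt (Comp.last _) hi.wk) (.imp (compP_inMod (Comp.last Γ)).not
      (compP_adj (Γ := Γ.ext) hi.wk (Comp.last _)))))

theorem loopBound_colors_succ : LoopBound (P := EC) fun x => colors x + 1 :=
  loopBound_colors.add (.const 1)

theorem loopBound_tableSize : LoopBound (P := EC) fun x => tableSize x :=
  loopBound_two_pow_special.mul loopBound_colors_succ

theorem compP_entry {T m c : α → ℕ} (hT : Comp Γ T) (hm : Comp Γ m) (hc : Comp Γ c) :
    CompP Γ fun a => Entry (Γ.inst a) (T a) (m a) (c a) :=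
  CompP.mem loopBound_tableSize hT ((hm.mul loopBound_colors_succ).add hc)

theorem compP_nextEntry {g L i T m c : α → ℕ} (hg : Comp Γ g) (hL : Comp Γ L) (hi : Comp Γ i)
    (hT : Comp Γ T) (hm : Comp Γ m) (hc : Comp Γ c) :
    CompP Γ fun a => NextEntry (Γ.inst a) (g a) (L a) (i a) (T a) (m a) (c a) := by
  refine CompP.or ((compP_isRep hi).not.and (compP_entry hT hm hc)) ((compP_isRep hi).and ?_)
  exact CompP.exists (p := fun _ _ => _) loopBound_two_pow_special
    (.and (CompP.forall (Γ := Γ.ext) (p := fun _ _ => _) loopBound_special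
      (.imp (compP_mem_special (Γ := Γ.ext.ext) (Comp.last _).wk (Comp.last _))
        (compP_mem_special (Γ := Γ.ext.ext) hm.wk.wk (Comp.last _))))
      (CompP.exists (Γ := Γ.ext) (p := fun _ _ => _) loopBound_colors_succ
        (.and (.le (Comp.last _) hc.wk.wk)
          (.and (compP_entry (Γ := Γ.ext.ext) hT.wk.wk (Comp.last _).wk (Comp.last _))
            (compP_feasibleCode (Γ := Γ.ext.ext) hg.wk.wk hL.wk.wk hi.wk.wk (Comp.last _).wk
              hm.wk.wk (hc.wk.wk.sub (Comp.last _)))))))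

theorem comp_nextTable {g L i T : α → ℕ} (hg : Comp Γ g) (hL : Comp Γ L) (hi : Comp Γ i)
    (hT : Comp Γ T) : Comp Γ fun a => nextTable (Γ.inst a) (g a) (L a) (i a) (T a) :=
  Comp.tab (p := fun _ _ => _) loopBound_tableSize
    (CompP.exists (Γ := Γ.ext) (p := fun _ _ => _) loopBound_two_pow_special
      (CompP.exists (Γ := Γ.ext.ext) (p := fun _ _ => _) loopBound_colors_succ
        (.and (.eq (Comp.last _).wk.wk (Comp.add (Γ := Γ.ext.ext.ext)
            (Comp.mul (Γ := Γ.ext.ext.ext) (Comp.last _).wk loopBound_colors_succ) (Comp.last _)))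
          (compP_nextEntry (Γ := Γ.ext.ext.ext) hg.wk.wk.wk hL.wk.wk.wk hi.wk.wk.wk hT.wk.wk.wk
            (Comp.last _).wk (Comp.last _)))))

theorem comp_table {g L : α → ℕ} (hg : Comp Γ g) (hL : Comp Γ L) :
    Comp Γ fun a => table (Γ.inst a) (g a) (L a) (EqColInstance.n (Γ.inst a)) :=
  Comp.rounds (G := fun _ _ _ => _) loopBound_n
    (Comp.tab (p := fun _ _ => _) loopBound_tableSize (.eq (Comp.last Γ) (Comp.const _ 0)))
    (comp_nextTable (Γ := Γ.ext.ext) hg.wk.wk hL.wk.wk (Comp.last _).wk (Comp.last _))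

theorem compP_accepts (Γ : Ctx EC α) : CompP Γ fun a => Accepts (Γ.inst a) :=
  CompP.exists (p := fun _ _ => _) loopBound_two_pow_modSize_sq
    (.and (compP_isColorCode (Γ := Γ.ext) (Comp.last _))
      (CompP.exists (Γ := Γ.ext) (p := fun _ _ => _) loopBound_two_pow_special
        (.and (CompP.forall (Γ := Γ.ext.ext) (p := fun _ _ => _) loopBound_special
          (.le (comp_modCount (Γ := Γ.ext.ext.ext) (Comp.last _).wk.wk (Comp.last _))
            (comp_target (Γ := Γ.ext.ext.ext) (Comp.last _).wk (Comp.last _))))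
          (CompP.exists (Γ := Γ.ext.ext) (p := fun _ _ => _) loopBound_two_pow_special
            (.and (CompP.forall (Γ := Γ.ext.ext.ext) (p := fun _ _ => _) loopBound_special
              (.imp (.lt (Comp.const _ 0) (comp_missing (Γ := Γ.ext.ext.ext.ext)
                  (Comp.last _).wk.wk.wk (Comp.last _).wk.wk (Comp.last _)))
                (compP_mem_special (Γ := Γ.ext.ext.ext.ext) (Comp.last _).wk (Comp.last _))))
              (compP_entry (Γ := Γ.ext.ext.ext)
                (comp_table (Γ := Γ.ext.ext.ext) (Comp.last _).wk.wk (Comp.last _).wk)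
                (Comp.last _)
                ((loopBound_colors.comp Γ.ext.ext.ext).sub
                  (loopBound_special.comp Γ.ext.ext.ext))))))))

end EquitableColoringComp

theorem mainTheorem2 : equitableColoringByDistToCoCluster.IsFPT := by
  refine RAM.isFPT_of_comp EquitableColoringComp.inputSize_pos
    (EquitableColoringComp.compP_accepts _) (fun x h => RAM.ind_true ?_) fun x h => RAM.ind_false ?_
  · exact EqColInstance.accepts_iff.2 (EqColInstance.equitablyColorable_iff.1 h)
  · exact fun h' => h (EqColInstance.equitablyColorable_iff.2 (EqColInstance.accepts_iff.1 h'))
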